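/- **Setting.** Let $\Sigma$ consist of a constant $\emptyset$, a binary symbol $\cup$ and an arbitrary collection of free function symbols $f$, each with a fixed arity $n\ge 0$; let $\mathcal V$ be an infinite set of variables, and consider the terms over $\Sigma$ and $\mathcal V$. Let $=_{ACI1}$ be the least congruence on terms, closed under substitution, that contains $(x\cup y)\cup z\approx x\cup(y\cup z)$, $x\cup y\approx y\cup x$, $x\cup x\approx x$ and $x\cup\emptyset\approx x$. An ACI1-unifier of a finite system $\mathcal E$ of equations between terms is a substitution $\sigma$ with $s\sigma=_{ACI1}t\sigma$ for every equation $s=t$ in $\mathcal E$. For substitutions $\theta,\sigma$ write $\theta\le\sigma$ if there is a substitution $\delta$ with $\sigma(X)=_{ACI1}(\theta(X))\delta$ for all $X\in vars(\mathcal E)$. Using (A), (C), (1), every term can be written as $f_1(\bar s_1)\cup\dots\cup f_n(\bar s_n)\cup V_1\cup\dots\cup V_m$ ($n,m\ge0$, $f_i$ free, $V_i$ variables; the empty union is $\emptyset$); the $f_i(\bar s_i)$ are its *top compound terms* and the $V_i$ its *top variables*. **Procedure** $general\_aci(\mathcal E)$. Start with $\mathcal E_s:=\emptyset$ and $\mathcal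 E_{ns}:=\mathcal E$. While $\mathcal E_{ns}\ne\emptyset$, select and remove an arbitrary equation $e$ of $\mathcal E_{ns}$ and apply the rule below for its form. "New" variables are variables that have not occurred before in the computation; their names are arbitrary. 1. $X=X$: nothing is added. 2. $t=X$, $t$ not a variable: add $X=t$ to $\mathcal E_{ns}$. 3. $X=t$, where $X$ occurs inside some top compound term of $t$: fail. 4. $X=t$, where $X$ does not occur in $t$: apply $[X/t]$ to $\mathcal E_s$ and $\mathcal E_{ns}$ and add $X=t$ to $\mathcal E_s$. 5. $X=t$, where $t\neq X$ and $X$ is a top variable of $t$ that occurs in no top compound term of $t$: let $t'$ be the union of the top compound terms and of the other top variables of $t$; add $X=t'\cup N$ to $\mathcal E_{ns}$, with $N$ a new variable. 6. $s=t$, where $s,t$ are not variables, have different outermost symbols, and neither outermost symbol is $\cup$: fail. 7. $f(s_1,\dots,s_n)=f(t_1,\dots,t_n)$ with $f\ne\cup$: add $s_1=t_1,\dots,s_n=t_n$ to $\mathcal E_{ns}$. 8. $s=t$, where $s,t$ are not variables and at least one of them has outermost symbol $\cup$: let $\langle\mathcal E_1,\mathcal E_2\rho,\rho\rangle$ be a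 result of $aci\_step(s=t)$. Replace $\mathcal E_s$ by $\mathcal E_s\rho$ together with the equations $X=\rho(X)$ for the variables $X$ solved by $\mathcal E_1$, and $\mathcal E_{ns}$ by $\mathcal E_{ns}\rho$ together with $\mathcal E_2\rho$; fail if $aci\_step$ fails. When $\mathcal E_{ns}=\emptyset$, return $[X_1/t_1,\dots,X_n/t_n]$, where $\mathcal E_s=\{X_1=t_1,\dots,X_n=t_n\}$. **The function** $aci\_step(s=t)$. Let $p_1,\dots,p_{k_1}$ and $q_1,\dots,q_{h_1}$ be the top compound terms of $s$ and of $t$ without repetitions; let $L_1,\dots,L_{k_2}$, $R_1,\dots,R_{h_2}$ and $C_1,\dots,C_c$ be the distinct top variables of $s$ only, of $t$ only, and of both. Form a matrix with rows $q_1,\dots,q_{h_1},R_1,\dots,R_{h_2},C_1,\dots,C_c$ and columns $p_1,\dots,p_{k_1},L_1,\dots,L_{k_2},C_1,\dots,C_c$, with a distinct new variable $A_{i,j}$ in each position, except that the positions of two different $C_u,C_v$ are left out. Guess, for each position in a row $q_i$ or in a column $p_j$, a bit, such that each row $q_i$ and each column $p_j$ contains at least one bit $1$. Put $\lambda(A_{i,j})=\emptyset$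 where the bit is $0$; where it is $1$ put $\lambda(A_{i,j})=p_j$ in a column $p_j$ and $\lambda(A_{i,j})=q_i$ otherwise; put $\lambda(A_{i,j})=A_{i,j}$ where there is no bit. If some position $(q_i,p_j)$ has bit $1$ and $p_j$, $q_i$ have different heads, fail. Let $\mathcal E_2$ consist of the equations $\bar l=\bar r$ between corresponding arguments, for all positions $(q_i,p_j)$ with bit $1$, where $p_j=f(\bar l)$ and $q_i=f(\bar r)$. Let $\mathcal E_1$ contain for each $L_j$ the equation that equates it to the union of the $\lambda$-values in its column, for each $R_i$ the equation that equates it to the union of the $\lambda$-values in its row, and for each $C_v$ the equation that equates it to the union of the $\lambda$-values in its column and in its row (without repetitions and without superfluous $\emptyset$). Write $X\Rightarrow Y$ if $Y$ occurs in the right-hand side of the equation of $\mathcal E_1$ for $X$; if $X\Rightarrow^+X$ for some $X$, where $\Rightarrow^+$ is the transitive closure, fail. Otherwise let $\rho$ be the substitution obtained by composing the replacements of $\mathcal E_1$ until none of the $L_j,R_i,C_v$ is left. **Theorem.** The procedure $general\_aci$ is correct and complete for general ACI1 unification: for every finite system $\mathcal E$, and for every way of making the don't-care choices (the selection of equations and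 the names of new variables, possibly depending on the history of the computation), the set of substitutions returned by the branches of the computation of $general\_aci(\mathcal E)$ (one for each way of making the guesses in the calls of $aci\_step$) is a complete set of ACI1-unifiers of $\mathcal E$. That is, every returned substitution is an ACI1-unifier of $\mathcal E$, and for every ACI1-unifier $\sigma$ of $\mathcal E$ some returned $\theta$ satisfies $\theta\le\sigma$. -/

import Mathlib

namespace ACI1

universe u v

/-- Terms over the signature consisting of the constant `∅`, the binary symbol `∪` and the free
function symbols `f : F`, where `f` has arity `ar f`; variables are taken from `V`. -/
inductive Term {F : Type u} (ar : F → ℕ) (V : Type v) : Type (max u v)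
  | var (X : V) : Term ar V
  | empty : Term ar V
  | union (s t : Term ar V) : Term ar V
  | app (f : F) (ts : Fin (ar f) → Term ar V) : Term ar V

/-- Substitutions, as functions from variables to terms. -/
abbrev Subst {F : Type u} (ar : F → ℕ) (V : Type v) : Type (max u v) := V → Term ar V

/-- Equations `l = r`. -/
abbrev Eqn {F : Type u} (ar : F → ℕ) (V : Type v) : Type (max u v) := Term ar V × Term ar V

/-- A compound term `f(s₁, …, sₙ)` with `f` free, given as its head together with its arguments. -/
abbrev Comp {F : Type u} (ar : F → ℕ) (V : Type v) : Type (max u v) :=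
  Σ f : F, (Fin (ar f) → Term ar V)

section

variable {F : Type u} {ar : F → ℕ} {V : Type v}

namespace Term

/-- `t.subst σ` is `tσ`. -/
def subst (σ : Subst ar V) : Term ar V → Term ar V
  | var X => σ X
  | empty => empty
  | union s t => union (s.subst σ) (t.subst σ)
  | app f ts => app f (fun i => (ts i).subst σ)

/-- The variables that occur in a term. -/
def vars [DecidableEq V] : Term ar V → Finset V
  | var X => {X}
  | empty => ∅
  | union s t => s.vars ∪ t.vars
  | app _ ts => Finset.univ.biUnion (fun i => (ts i).vars)

/-- The term is a variable. -/
def IsVar : Term ar V → Prop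
  | var _ => True
  | _ => False

/-- The outermost symbol of the term is `∪`. -/
def IsUnion : Term ar V → Prop
  | union _ _ => True
  | _ => False

/-- The variables `V₁, …, Vₘ` of the decomposition
`t = f₁(s̄₁) ∪ ⋯ ∪ fₙ(s̄ₙ) ∪ V₁ ∪ ⋯ ∪ Vₘ` modulo associativity, commutativity and identity
(with repetitions). -/
def topVars : Term ar V → List V
  | var X => [X]
  | empty => []
  | union s t => s.topVars ++ t.topVars
  | app _ _ => []

/-- The compound terms `f₁(s̄₁), …, fₙ(s̄ₙ)` of the same decomposition (with repetitions). -/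
def topComps : Term ar V → List (Comp ar V)
  | var _ => []
  | empty => []
  | union s t => s.topComps ++ t.topComps
  | app f ts => [⟨f, ts⟩]

end Term

/-- The term denoted by a head with its arguments. -/
def Comp.toTerm (p : Comp ar V) : Term ar V := Term.app p.1 p.2

/-- The equational theory `=_{ACI1}`: the least congruence on terms that contains all
substitution instances of associativity, commutativity, idempotence and identity. -/
inductive EqACI1 : Term ar V → Term ar V → Prop
  | refl (s) : EqACI1 s s
  | symm {s t} : EqACI1 s t → EqACI1 t s
  | trans {s t w} : EqACI1 s t → EqACI1 t w → EqACI1 s w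
  | congr_union {s s' t t'} : EqACI1 s s' → EqACI1 t t' → EqACI1 (.union s t) (.union s' t')
  | congr_app (f : F) {ss ts : Fin (ar f) → Term ar V} :
      (∀ i, EqACI1 (ss i) (ts i)) → EqACI1 (.app f ss) (.app f ts)
  | assoc (x y z) : EqACI1 (.union (.union x y) z) (.union x (.union y z))
  | comm (x y) : EqACI1 (.union x y) (.union y x)
  | idem (x) : EqACI1 (.union x x) x
  | ident (x) : EqACI1 (.union x .empty) x

/-- Application of a substitution to an equation. -/
def Eqn.subst (σ : Subst ar V) (e : Eqn ar V) : Eqn ar V := (e.1.subst σ, e.2.subst σ)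

/-- `σ` is an ACI1-unifier of the system `E`. -/
def IsUnifier (E : List (Eqn ar V)) (σ : Subst ar V) : Prop :=
  ∀ e ∈ E, EqACI1 (e.1.subst σ) (e.2.subst σ)

/-- The variables of a system. -/
def sysVars [DecidableEq V] (E : List (Eqn ar V)) : Finset V :=
  E.foldr (fun e W => e.1.vars ∪ e.2.vars ∪ W) ∅

/-- `θ ≤ σ` on the set of variables `W`, modulo ACI1: some substitution `δ` (with finite domain)
satisfies `σ(X) =_{ACI1} (θ(X))δ` for all `X ∈ W`, so that `σ` is on `W` an instance of `θ`. -/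
def MoreGeneral (W : Finset V) (θ σ : Subst ar V) : Prop :=
  ∃ δ : Subst ar V, {X | δ X ≠ .var X}.Finite ∧ ∀ X ∈ W, EqACI1 (σ X) ((θ X).subst δ)

/-- `C` is a complete set of ACI1-unifiers of `E`. -/
def IsCompleteSetOfUnifiers [DecidableEq V] (E : List (Eqn ar V)) (C : Set (Subst ar V)) : Prop :=
  (∀ θ ∈ C, IsUnifier E θ) ∧
    ∀ σ, IsUnifier E σ → ∃ θ ∈ C, MoreGeneral (sysVars E) θ σ

/-- `t₁ ∪ ⋯ ∪ tₙ`; the empty union is `∅`. -/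
def joinUnion : List (Term ar V) → Term ar V
  | [] => .empty
  | [t] => t
  | t :: t' :: ts => .union t (joinUnion (t' :: ts))

open Classical in
/-- The union of the terms of a list, without repetitions. -/
noncomputable def bigUnion (l : List (Term ar V)) : Term ar V := joinUnion l.dedup

/-- The equations `s̄ = t̄` between the arguments of two compound terms
(used for terms with the same head only). -/
def argEqs (p q : Comp ar V) : List (Eqn ar V) := (List.ofFn p.2).zip (List.ofFn q.2)

/-- The substitution `[X₁/t₁, …, Xₙ/tₙ]` read off the list of the equations `Xᵢ = tᵢ`. -/
def substOf [DecidableEq V] (l : List (V × Term ar V)) : Subst ar V :=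
  fun X => (l.lookup X).getD (.var X)

/-- The `n`-fold composition of a substitution with itself. -/
def iterSubst (σ : Subst ar V) : ℕ → Subst ar V
  | 0 => Term.var
  | n + 1 => fun X => (iterSubst σ n X).subst σ

/-- An equation between two set terms, in the normalised form
`f₁(l̄₁) ∪ ⋯ ∪ L₁ ∪ ⋯ ∪ Com₁ ∪ ⋯ = g₁(r̄₁) ∪ ⋯ ∪ R₁ ∪ ⋯ ∪ Com₁ ∪ ⋯`. -/
structure SetEqn {F : Type u} (ar : F → ℕ) (V : Type v) where
  /-- `f₁(l̄₁), f₂(l̄₂), …` -/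
  P : List (Comp ar V)
  /-- the variables of the left-hand side only -/
  L : List V
  /-- `g₁(r̄₁), g₂(r̄₂), …` -/
  Q : List (Comp ar V)
  /-- the variables of the right-hand side only -/
  R : List V
  /-- the variables common to the two sides -/
  C : List V

open Classical in
/-- Normalisation of `s = t` (occurrences of `∅` and repetitions at the outermost level are
dropped). -/
noncomputable def setForm (s t : Term ar V) : SetEqn ar V where
  P := s.topComps.dedup
  L := (s.topVars.filter (fun X => X ∉ t.topVars)).dedup
  Q := t.topComps.dedup
  R := (t.topVars.filter (fun X => X ∉ s.topVars)).dedup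
  C := (s.topVars.filter (fun X => X ∈ t.topVars)).dedup

/-- The nondeterministic guess of term propagation. The elementary ACI1 solution has one variable
`A i j` for every row `i` and column `j`: the columns belong to `P`, `L`, `C` (in this order), the
rows to `Q`, `R`, `C`, and a pair of two different common variables is not used.
The guess is a Boolean matrix on the five blocks in which a compound term is involved: entry `0`
binds `A i j` to `∅`, entry `1` binds it to the compound term of that row or column. Every
compound term has at least one entry `1` in its row or column. On the remaining four blocks
`A i j` stays a variable. -/
structure Guess (e : SetEqn ar V) where
  QP : Fin e.Q.length → Fin e.P.length → Bool
  QL : Fin e.Q.length → Fin e.L.length → Bool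
  QC : Fin e.Q.length → Fin e.C.length → Bool
  RP : Fin e.R.length → Fin e.P.length → Bool
  CP : Fin e.C.length → Fin e.P.length → Bool
  row : ∀ i, (∃ j, QP i j = true) ∨ (∃ j, QL i j = true) ∨ (∃ v, QC i v = true)
  col : ∀ j, (∃ i, QP i j = true) ∨ (∃ i, RP i j = true) ∨ (∃ v, CP v j = true)

namespace Guess

variable {e : SetEqn ar V} (B : Guess e) (A : ℕ × ℕ → V)

/-- No two terms with different heads are made equal. -/
def NoClash : Prop := ∀ i j, B.QP i j = true → (e.P.get j).1 = (e.Q.get i).1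

/-- The system `E₂`: the equations between arguments of compound terms that are made equal. -/
def E₂ : List (Eqn ar V) :=
  (List.finRange e.Q.length).flatMap fun i => (List.finRange e.P.length).flatMap fun j =>
    if B.QP i j = true then argEqs (e.P.get j) (e.Q.get i) else []

/-- The right-hand side of the equation for the `j`-th variable of the left-hand side only. -/
noncomputable def rhsL (j : Fin e.L.length) : Term ar V := bigUnion
  ((((List.finRange e.Q.length).filter fun i => B.QL i j).map fun i => (e.Q.get i).toTerm) ++
   (List.finRange e.R.length).map (fun i => .var (A (e.Q.length + i, e.P.length + j))) ++
   (List.finRange e.C.length).map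
     (fun v => .var (A (e.Q.length + e.R.length + v, e.P.length + j))))

/-- The right-hand side of the equation for the `i`-th variable of the right-hand side only. -/
noncomputable def rhsR (i : Fin e.R.length) : Term ar V := bigUnion
  ((((List.finRange e.P.length).filter fun j => B.RP i j).map fun j => (e.P.get j).toTerm) ++
   (List.finRange e.L.length).map (fun j => .var (A (e.Q.length + i, e.P.length + j))) ++
   (List.finRange e.C.length).map
     (fun v => .var (A (e.Q.length + i, e.P.length + e.L.length + v))))

/-- The right-hand side of the equation for the `v`-th common variable: column `v` and row `v`. -/
noncomputable def rhsC (v : Fin e.C.length) : Term ar V := bigUnion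
  ((((List.finRange e.Q.length).filter fun i => B.QC i v).map fun i => (e.Q.get i).toTerm) ++
   (List.finRange e.R.length).map
     (fun i => .var (A (e.Q.length + i, e.P.length + e.L.length + v))) ++
   (((List.finRange e.P.length).filter fun j => B.CP v j).map fun j => (e.P.get j).toTerm) ++
   (List.finRange e.L.length).map
     (fun j => .var (A (e.Q.length + e.R.length + v, e.P.length + j))) ++
   [.var (A (e.Q.length + e.R.length + v, e.P.length + e.L.length + v))])

/-- The system `E₁`: one equation for every variable at the outermost level. -/
noncomputable def E₁ : List (V × Term ar V) :=
  List.ofFn (fun j => (e.L.get j, B.rhsL A j)) ++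
  List.ofFn (fun i => (e.R.get i, B.rhsR A i)) ++
  List.ofFn (fun v => (e.C.get v, B.rhsC A v))

/-- `X ⇒ Y`: the variable `Y` occurs in the right-hand side of the equation for `X`. -/
def Dep [DecidableEq V] (X Y : V) : Prop := ∃ t, (X, t) ∈ B.E₁ A ∧ Y ∈ t.vars

/-- The test of variables removal. -/
def Acyclic [DecidableEq V] : Prop := ∀ X, ¬ Relation.TransGen (B.Dep A) X X

/-- The substitution `ρ` that removes all the variables at the outermost level: the
substitution given by `E₁`, composed with itself as often as there are equations, so that (by
acyclicity) none of these variables is left. -/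
noncomputable def rho [DecidableEq V] : Subst ar V :=
  iterSubst (substOf (B.E₁ A)) (B.E₁ A).length

end Guess

/-- A state of the procedure. -/
structure State {F : Type u} (ar : F → ℕ) (V : Type v) where
  /-- the equations in solved form -/
  solved : List (V × Term ar V)
  /-- the equations that still have to be processed -/
  pending : List (Eqn ar V)
  /-- the variables that have been used so far -/
  used : Finset V

/-- A don't-care choice in a state: a pending equation, and names, not used so far, for the new
variables that its processing may need. -/
structure Choice (s : State ar V) where
  idx : Fin s.pending.length
  fresh : ℕ × ℕ → V
  fresh_injective : Function.Injective fresh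
  fresh_new : ∀ p, fresh p ∉ s.used

/-- The selected equation. -/
def Choice.eqn {s : State ar V} (c : Choice s) : Eqn ar V := s.pending.get c.idx

/-- The other pending equations. -/
def Choice.rest {s : State ar V} (c : Choice s) : List (Eqn ar V) := s.pending.eraseIdx c.idx

/-- Application of a substitution to the right-hand sides of a list of equations `X = t`. -/
def substSolved (σ : Subst ar V) (l : List (V × Term ar V)) : List (V × Term ar V) :=
  l.map fun p => (p.1, p.2.subst σ)

/-- One non-failing iteration of `general_aci`, processing the equation selected by `c`.
No step is possible for a selected equation on which the procedure fails: `X = t` with `X`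
inside one of the compound terms at the outermost level of `t`; an equation between terms with
different heads, none of which is `∪`; and an equation with a `∪` at the outermost level for which
the guess leads to a clash of heads or to a cycle. -/
inductive Step [DecidableEq V] (s : State ar V) (c : Choice s) : State ar V → Prop
  /-- `X = X` -/
  | trivial (X : V) (h : c.eqn = (.var X, .var X)) :
      Step s c ⟨s.solved, c.rest, s.used⟩
  /-- `t = X` -/
  | orient (t : Term ar V) (X : V) (h : c.eqn = (t, .var X)) (ht : ¬ t.IsVar) :
      Step s c ⟨s.solved, (.var X, t) :: c.rest, s.used⟩
  /-- `X = t`, where `X` does not occur in `t` -/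
  | bind (X : V) (t : Term ar V) (h : c.eqn = (.var X, t)) (hX : X ∉ t.vars) :
      Step s c
        ⟨(X, t) :: substSolved (substOf [(X, t)]) s.solved,
          c.rest.map (Eqn.subst (substOf [(X, t)])), s.used⟩
  /-- `X = t' ∪ X ∪ ⋯ ∪ X`, where `X` does not occur in `t'` -/
  | absorb (X : V) (t : Term ar V) (h : c.eqn = (.var X, t)) (ht : ¬ t.IsVar)
      (hX : X ∈ t.topVars) (hX' : ∀ p ∈ t.topComps, X ∉ p.toTerm.vars) :
      Step s c
        ⟨s.solved,
          (.var X, bigUnion (t.topComps.map Comp.toTerm ++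
            (t.topVars.filter (fun Y => Y ≠ X)).map .var ++ [.var (c.fresh (0, 0))])) :: c.rest,
          insert (c.fresh (0, 0)) s.used⟩
  /-- `f(s₁, …, sₙ) = f(t₁, …, tₙ)` with `f` free -/
  | decompose (f : F) (ss ts : Fin (ar f) → Term ar V) (h : c.eqn = (.app f ss, .app f ts)) :
      Step s c ⟨s.solved, argEqs ⟨f, ss⟩ ⟨f, ts⟩ ++ c.rest, s.used⟩
  /-- `∅ = ∅` -/
  | decompose_empty (h : c.eqn = (.empty, .empty)) :
      Step s c ⟨s.solved, c.rest, s.used⟩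
  /-- an equation between non-variable terms with a `∪` at the outermost level: `aci_step` -/
  | aciStep (l r : Term ar V) (h : c.eqn = (l, r)) (hl : ¬ l.IsVar) (hr : ¬ r.IsVar)
      (hlr : l.IsUnion ∨ r.IsUnion) (B : Guess (setForm l r)) (hB : B.NoClash)
      (hB' : B.Acyclic c.fresh) :
      Step s c
        ⟨substSolved (B.rho c.fresh) (s.solved ++ (B.E₁ c.fresh).map fun p => (p.1, .var p.1)),
          (B.E₂ ++ c.rest).map (Eqn.subst (B.rho c.fresh)),
          s.used ∪
            (Finset.range
                ((setForm l r).Q.length + (setForm l r).R.length + (setForm l r).C.length) ×ˢ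
              Finset.range
                ((setForm l r).P.length + (setForm l r).L.length +
                  (setForm l r).C.length)).image c.fresh⟩

/-- A way to resolve the don't-care choices: a choice for every state with pending equations,
which may depend on the list of all the earlier states of the computation. -/
abbrev Strategy {F : Type u} (ar : F → ℕ) (V : Type v) : Type (max u v) :=
  (history : List (State ar V)) → (s : State ar V) → s.pending ≠ [] → Choice s

/-- `Reaches S E hist s`: the call `general_aci(E)`, with don't-care choices resolved by `S`, can
reach the state `s` through the list `hist` of earlier states (most recent first). -/
inductive Reaches [DecidableEq V] (S : Strategy ar V) (E : List (Eqn ar V)) :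
    List (State ar V) → State ar V → Prop
  | start : Reaches S E [] ⟨[], E, sysVars E⟩
  | step {hist : List (State ar V)} {s s' : State ar V} (hs : s.pending ≠ []) :
      Reaches S E hist s → Step s (S hist s hs) s' → Reaches S E (s :: hist) s'

/-- The substitution `θ` is returned by some branch of the computation of `general_aci(E)` with
don't-care choices resolved by `S`. -/
def Returns [DecidableEq V] (S : Strategy ar V) (E : List (Eqn ar V)) (θ : Subst ar V) : Prop :=
  ∃ hist s, Reaches S E hist s ∧ s.pending = [] ∧ θ = substOf s.solved

end

end ACI1

/-! Modulo ACI1 a term denotes a finite set, whose members are variables and compound terms, the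
latter up to ACI1 equality of their arguments. `Has` is membership in this set, and `eqACI1_iff`
says that ACI1 equality is extensionality; equations can thus be checked member by member.

Correctness: every solution of the state after a step solves the state before it (`Step.sat`). For
`aci_step` this is `Guess.eqACI1_of_solves`: the matrix hands each member of one side to a row or
column of the other. Solved variables occur nowhere else (`State.WF`), so the substitution read off
a final state solves that state, hence the input.

Completeness: a unifier `σ` dictates the guesses. In `exists_guess` a bit is 1 exactly when, under
`σ`, the compound term equals the compound term, or belongs to the value of the variable, at the
other end of its position; the new variable at a position between two variables takes the
intersection of their values. The unifier so extended solves the next state (`exists_step`). Head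
clashes are excluded by `EqACI1.head_eq`; occurs checks and cycles are excluded by the nesting depth
of free symbols, an ACI1 invariant that strictly drops inside a compound term.

Termination is needed only along the branch guided by the unifier. The measure is the multiset of
depths of the instantiated left-hand sides of the pending equations: eliminating variables leaves
the other depths unchanged, decomposition replaces one depth by finitely many smaller ones, and a
rank settles orientation and absorption, which keep the multiset. At the end the extended unifier
`τ` solves `X = θ(X)` for the returned `θ`, so it is an instance of `θ`. -/

namespace ACI1

universe u v

/-! ### Set semantics of ACI1 equality, and nesting depth -/

section Semantics

variable {F : Type u} {ar : F → ℕ} {V : Type v}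

/-- Equality of compound terms modulo ACI1: equal heads and equal arguments. -/
inductive CompEq : Comp ar V → Comp ar V → Prop
  | mk (f : F) {ss ts : Fin (ar f) → Term ar V} (h : ∀ i, EqACI1 (ss i) (ts i)) :
      CompEq ⟨f, ss⟩ ⟨f, ts⟩

theorem CompEq.refl (p : Comp ar V) : CompEq p p := ⟨p.1, fun _ => .refl _⟩

theorem CompEq.symm {p q : Comp ar V} : CompEq p q → CompEq q p
  | ⟨f, h⟩ => ⟨f, fun i => (h i).symm⟩

theorem CompEq.trans {p q r : Comp ar V} (hpq : CompEq p q) (hqr : CompEq q r) : CompEq p r := by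
  obtain ⟨f, h⟩ := hpq
  obtain ⟨_, h'⟩ := hqr
  exact ⟨f, fun i => (h i).trans (h' i)⟩

theorem CompEq.eqACI1 {p q : Comp ar V} : CompEq p q → EqACI1 p.toTerm q.toTerm
  | ⟨f, h⟩ => .congr_app f h

/-- `Has a t`: the variable or compound term `a` is, modulo ACI1, one of the members of the set
denoted by `t`. -/
def Has (a : V ⊕ Comp ar V) : Term ar V → Prop
  | .var X => a = .inl X
  | .empty => False
  | .union s t => Has a s ∨ Has a t
  | .app f ts => ∃ p, a = .inr p ∧ CompEq p ⟨f, ts⟩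

/-- Each ACI1 axiom turns into a law of disjunction, with `False` as the identity. -/
theorem has_congr {s t : Term ar V} (h : EqACI1 s t) (a : V ⊕ Comp ar V) : Has a s ↔ Has a t := by
  induction h with
  | refl => rfl
  | symm _ ih => exact ih.symm
  | trans _ _ ih₁ ih₂ => exact ih₁.trans ih₂
  | congr_union _ _ ih₁ ih₂ => exact or_congr ih₁ ih₂
  | congr_app f h _ =>
    exact exists_congr fun p => and_congr_right fun _ =>
      ⟨fun hp => hp.trans ⟨f, h⟩, fun hp => hp.trans (CompEq.symm ⟨f, h⟩)⟩
  | assoc => exact or_assoc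
  | comm => exact or_comm
  | idem => exact or_self_iff
  | ident => exact or_iff_left id

theorem has_of_compEq {p q : Comp ar V} (h : CompEq p q) (t : Term ar V) :
    Has (.inr p) t ↔ Has (.inr q) t := by
  induction t with
  | var X => simp [Has]
  | empty => rfl
  | union s t ih₁ ih₂ => exact or_congr ih₁ ih₂
  | app f ts =>
    simp only [Has, Sum.inr.injEq, exists_eq_left']
    exact ⟨h.symm.trans, h.trans⟩

/-- The term denoted by a member. -/
def memberTerm : V ⊕ Comp ar V → Term ar V
  | .inl X => .var X
  | .inr p => p.toTerm

theorem EqACI1.union_of_has {a : V ⊕ Comp ar V} {t : Term ar V} (h : Has a t) :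
    EqACI1 (.union (memberTerm a) t) t := by
  induction t with
  | var X => cases h; exact .idem _
  | empty => exact h.elim
  | union s t ih₁ ih₂ =>
    rcases h with h | h
    · exact (EqACI1.assoc _ _ _).symm.trans (.congr_union (ih₁ h) (.refl _))
    · refine (EqACI1.congr_union (.refl _) (.comm _ _)).trans ?_
      refine (EqACI1.assoc _ _ _).symm.trans ?_
      exact (EqACI1.congr_union (ih₂ h) (.refl _)).trans (.comm _ _)
  | app f ts =>
    obtain ⟨p, rfl, hp⟩ := h
    exact (EqACI1.congr_union hp.eqACI1 (.refl _)).trans (.idem _)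

/-- Inclusion of sets implies absorption: the members of `s` are absorbed into `t` one after the
other by `EqACI1.union_of_has`. -/
theorem EqACI1.union_of_forall_has {s t : Term ar V} (h : ∀ a, Has a s → Has a t) :
    EqACI1 (.union s t) t := by
  induction s with
  | var X => exact EqACI1.union_of_has (a := .inl X) (h _ rfl)
  | empty => exact (EqACI1.comm _ _).trans (.ident _)
  | union s₁ s₂ ih₁ ih₂ =>
    refine (EqACI1.assoc _ _ _).trans ?_
    refine (EqACI1.congr_union (.refl _) (ih₂ fun a ha => h a (.inr ha))).trans ?_
    exact ih₁ fun a ha => h a (.inl ha)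
  | app f ts => exact EqACI1.union_of_has (a := .inr ⟨f, ts⟩) (h _ ⟨_, rfl, .refl _⟩)

/-- Two sets included in each other are both equal to their union. -/
theorem eqACI1_iff {s t : Term ar V} : EqACI1 s t ↔ ∀ a, Has a s ↔ Has a t := by
  refine ⟨has_congr, fun h => ?_⟩
  refine (EqACI1.union_of_forall_has fun a => (h a).2).symm.trans ?_
  exact (EqACI1.comm _ _).trans (EqACI1.union_of_forall_has fun a => (h a).1)

/-- Keep the top-level parts of `s` that are members of `t` and replace the others by `∅`. These
intersections will be the values of the matrix variables. -/
theorem exists_inter (s t : Term ar V) : ∃ w : Term ar V, ∀ a, Has a w ↔ Has a s ∧ Has a t := by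
  induction s with
  | var X =>
    by_cases h : Has (.inl X) t
    · exact ⟨.var X, fun a => ⟨fun ha => ⟨ha, by cases ha; exact h⟩, fun ha => ha.1⟩⟩
    · exact ⟨.empty, fun a => ⟨False.elim, fun ha => h (by cases ha.1; exact ha.2)⟩⟩
  | empty => exact ⟨.empty, fun a => ⟨False.elim, fun ha => ha.1⟩⟩
  | union s₁ s₂ ih₁ ih₂ =>
    obtain ⟨w₁, h₁⟩ := ih₁
    obtain ⟨w₂, h₂⟩ := ih₂
    exact ⟨.union w₁ w₂, fun a => by simp only [Has, h₁, h₂, or_and_right]⟩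
  | app f ts =>
    by_cases h : Has (.inr ⟨f, ts⟩) t
    · refine ⟨.app f ts, fun a => ⟨fun ha => ⟨ha, ?_⟩, fun ha => ha.1⟩⟩
      obtain ⟨p, rfl, hp⟩ := ha
      exact (has_of_compEq hp t).2 h
    · refine ⟨.empty, fun a => ⟨False.elim, fun ha => h ?_⟩⟩
      obtain ⟨⟨p, rfl, hp⟩, ha⟩ := ha
      exact (has_of_compEq hp t).1 ha

/-- A term that denotes the intersection of two sets. -/
noncomputable def inter (s t : Term ar V) : Term ar V := (exists_inter s t).choose

theorem has_inter {s t : Term ar V} {a : V ⊕ Comp ar V} :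
    Has a (inter s t) ↔ Has a s ∧ Has a t := (exists_inter s t).choose_spec a

/-- Application of a substitution to a compound term. -/
def Comp.subst (σ : Subst ar V) (p : Comp ar V) : Comp ar V := ⟨p.1, fun i => (p.2 i).subst σ⟩

theorem Comp.toTerm_subst (σ : Subst ar V) (p : Comp ar V) :
    p.toTerm.subst σ = (p.subst σ).toTerm := rfl

theorem has_subst {σ : Subst ar V} {t : Term ar V} {a : V ⊕ Comp ar V} :
    Has a (t.subst σ) ↔
      (∃ X ∈ t.topVars, Has a (σ X)) ∨ ∃ p ∈ t.topComps, Has a (p.subst σ).toTerm := by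
  induction t with
  | var X => simp [Term.subst, Term.topVars, Term.topComps]
  | empty => simp [Term.subst, Term.topVars, Term.topComps, Has]
  | union s t ih₁ ih₂ =>
    simp only [Term.subst, Term.topVars, Term.topComps, Has, ih₁, ih₂, List.mem_append, or_and_right,
      exists_or]
    exact or_or_or_comm
  | app f ts => simp [Term.subst, Term.topVars, Term.topComps, Comp.toTerm, Comp.subst]

theorem has_joinUnion_subst {σ : Subst ar V} {l : List (Term ar V)} {a : V ⊕ Comp ar V} :
    Has a ((joinUnion l).subst σ) ↔ ∃ t ∈ l, Has a (t.subst σ) := by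
  induction l using joinUnion.induct with
  | case1 => simp [joinUnion, Term.subst, Has]
  | case2 t => simp [joinUnion]
  | case3 t t' ts ih =>
    rw [joinUnion, Term.subst, Has, ih]
    simp

theorem has_bigUnion_subst {σ : Subst ar V} {l : List (Term ar V)} {a : V ⊕ Comp ar V} :
    Has a ((bigUnion l).subst σ) ↔ ∃ t ∈ l, Has a (t.subst σ) := by
  simp [bigUnion, has_joinUnion_subst]

theorem mem_topVars_bigUnion {l : List (Term ar V)} {X : V} :
    X ∈ (bigUnion l).topVars ↔ ∃ t ∈ l, X ∈ t.topVars := by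
  classical
  suffices h : ∀ l : List (Term ar V), X ∈ (joinUnion l).topVars ↔ ∃ t ∈ l, X ∈ t.topVars by
    simp [bigUnion, h]
  intro l
  induction l using joinUnion.induct with
  | case1 => simp [joinUnion, Term.topVars]
  | case2 t => simp [joinUnion]
  | case3 t t' ts ih => simp [joinUnion, Term.topVars, ih]

theorem mem_topComps_bigUnion {l : List (Term ar V)} {p : Comp ar V} :
    p ∈ (bigUnion l).topComps ↔ ∃ t ∈ l, p ∈ t.topComps := by
  classical
  suffices h : ∀ l : List (Term ar V), p ∈ (joinUnion l).topComps ↔ ∃ t ∈ l, p ∈ t.topComps by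
    simp [bigUnion, h]
  intro l
  induction l using joinUnion.induct with
  | case1 => simp [joinUnion, Term.topComps]
  | case2 t => simp [joinUnion]
  | case3 t t' ts ih => simp [joinUnion, Term.topComps, ih]

namespace Term

theorem subst_subst (σ τ : Subst ar V) (t : Term ar V) :
    (t.subst σ).subst τ = t.subst (fun X => (σ X).subst τ) := by
  induction t with
  | var X => rfl
  | empty => rfl
  | union s t ih₁ ih₂ => simp only [subst, ih₁, ih₂]
  | app f ts ih => simp only [subst, ih]

theorem subst_var (t : Term ar V) : t.subst var = t := by
  induction t with
  | var X => rfl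
  | empty => rfl
  | union s t ih₁ ih₂ => simp only [subst, ih₁, ih₂]
  | app f ts ih => simp only [subst, ih]

section Vars

variable [DecidableEq V]

theorem subst_congr {σ τ : Subst ar V} {t : Term ar V} (h : ∀ X ∈ t.vars, EqACI1 (σ X) (τ X)) :
    EqACI1 (t.subst σ) (t.subst τ) := by
  induction t with
  | var X => exact h X (by simp [vars])
  | empty => exact .refl _
  | union s t ih₁ ih₂ =>
    exact .congr_union (ih₁ fun X hX => h X (by simp [vars, hX]))
      (ih₂ fun X hX => h X (by simp [vars, hX]))
  | app f ts ih =>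
    exact .congr_app f fun i => ih i fun X hX => h X <|
      Finset.mem_biUnion.2 ⟨i, Finset.mem_univ i, hX⟩

theorem subst_eq_of_vars {σ τ : Subst ar V} {t : Term ar V} (h : ∀ X ∈ t.vars, σ X = τ X) :
    t.subst σ = t.subst τ := by
  induction t with
  | var X => exact h X (by simp [vars])
  | empty => rfl
  | union s t ih₁ ih₂ =>
    simp only [subst]
    rw [ih₁ fun X hX => h X (by simp [vars, hX]), ih₂ fun X hX => h X (by simp [vars, hX])]
  | app f ts ih =>
    simp only [subst]
    congr 1
    ext1 i
    exact ih i fun X hX => h X <|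
      Finset.mem_biUnion.2 ⟨i, Finset.mem_univ i, hX⟩

theorem mem_vars_subst {σ : Subst ar V} {t : Term ar V} {Y : V} :
    Y ∈ (t.subst σ).vars ↔ ∃ X ∈ t.vars, Y ∈ (σ X).vars := by
  induction t with
  | var X => simp [subst, vars]
  | empty => simp [subst, vars]
  | union s t ih₁ ih₂ => simp only [subst, vars, Finset.mem_union, ih₁, ih₂, or_and_right, exists_or]
  | app f ts ih =>
    simp only [subst, vars, Finset.mem_biUnion, Finset.mem_univ, true_and, ih]
    exact ⟨fun ⟨i, X, h, h'⟩ => ⟨X, ⟨i, h⟩, h'⟩, fun ⟨X, ⟨i, h⟩, h'⟩ => ⟨i, X, h, h'⟩⟩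

theorem mem_vars_iff {t : Term ar V} {Y : V} :
    Y ∈ t.vars ↔ Y ∈ t.topVars ∨ ∃ p ∈ t.topComps, Y ∈ p.toTerm.vars := by
  induction t with
  | var X => simp [vars, topVars, topComps]
  | empty => simp [vars, topVars, topComps]
  | union s t ih₁ ih₂ =>
    simp only [vars, topVars, topComps, Finset.mem_union, List.mem_append, ih₁, ih₂, or_and_right,
      exists_or]
    exact or_or_or_comm
  | app f ts => simp [topVars, topComps, Comp.toTerm]

end Vars

/-- The nesting depth of free function symbols. -/
def height : Term ar V → ℕ
  | var _ => 0
  | empty => 0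
  | union s t => max s.height t.height
  | app _ ts => (Finset.univ.sup fun i => (ts i).height) + 1

theorem height_arg_lt (f : F) (ts : Fin (ar f) → Term ar V) (i : Fin (ar f)) :
    (ts i).height < (app f ts).height :=
  Nat.lt_succ_of_le (Finset.le_sup (f := fun i => (ts i).height) (Finset.mem_univ i))

/-- `max` on `ℕ` is itself associative, commutative and idempotent with identity 0; this is why
depth is an invariant, while size is not. -/
theorem height_congr {s t : Term ar V} (h : EqACI1 s t) : s.height = t.height := by
  induction h with
  | refl => rfl
  | symm _ ih => exact ih.symm
  | trans _ _ ih₁ ih₂ => exact ih₁.trans ih₂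
  | congr_union _ _ ih₁ ih₂ => simp only [height, ih₁, ih₂]
  | congr_app f _ ih => simp only [height, ih]
  | assoc => exact max_assoc _ _ _
  | comm => exact max_comm _ _
  | idem => exact max_self _
  | ident => exact max_eq_left (Nat.zero_le _)

theorem height_subst_le_of_mem_vars [DecidableEq V] {σ : Subst ar V} {t : Term ar V} {X : V}
    (h : X ∈ t.vars) : (σ X).height ≤ (t.subst σ).height := by
  induction t with
  | var Y => simp only [vars, Finset.mem_singleton] at h; subst h; rfl
  | empty => simp [vars] at h
  | union s t ih₁ ih₂ =>
    simp only [vars, Finset.mem_union] at h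
    exact h.elim (fun h => (ih₁ h).trans (le_max_left _ _)) fun h => (ih₂ h).trans (le_max_right _ _)
  | app f ts ih =>
    simp only [vars, Finset.mem_biUnion, Finset.mem_univ, true_and] at h
    obtain ⟨i, h⟩ := h
    exact (ih i h).trans (height_arg_lt f (fun i => (ts i).subst σ) i).le

theorem height_topComp_le {σ : Subst ar V} {t : Term ar V} {p : Comp ar V} (h : p ∈ t.topComps) :
    (p.toTerm.subst σ).height ≤ (t.subst σ).height := by
  induction t with
  | var Y => simp [topComps] at h
  | empty => simp [topComps] at h
  | union s t ih₁ ih₂ =>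
    simp only [topComps, List.mem_append] at h
    exact h.elim (fun h => (ih₁ h).trans (le_max_left _ _)) fun h => (ih₂ h).trans (le_max_right _ _)
  | app f ts =>
    simp only [topComps, List.mem_singleton] at h
    subst h
    rfl

/-- The occurs check in semantic form: it excludes `X = t` with `X` inside a compound term, and
cycles in `E₁`. -/
theorem height_var_lt_topComp [DecidableEq V] {σ : Subst ar V} {t : Term ar V} {p : Comp ar V}
    (h : p ∈ t.topComps) {X : V} (hX : X ∈ p.toTerm.vars) :
    (σ X).height < (t.subst σ).height := by
  refine lt_of_lt_of_le ?_ (height_topComp_le h)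
  simp only [Comp.toTerm, vars, Finset.mem_biUnion, Finset.mem_univ, true_and] at hX
  obtain ⟨i, hi⟩ := hX
  exact (height_subst_le_of_mem_vars hi).trans_lt
    (height_arg_lt p.1 (fun i => (p.2 i).subst σ) i)

end Term

theorem mem_argEqs (f : F) {ss ts : Fin (ar f) → Term ar V} {e : Eqn ar V} :
    e ∈ argEqs ⟨f, ss⟩ ⟨f, ts⟩ ↔ ∃ i, e = (ss i, ts i) := by
  rw [argEqs, List.mem_iff_getElem]
  simp only [List.getElem_zip, List.getElem_ofFn, List.length_zip, List.length_ofFn, min_self]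
  exact ⟨fun ⟨i, h, h'⟩ => ⟨⟨i, h⟩, h'.symm⟩, fun ⟨i, h⟩ => ⟨i, i.2, h.symm⟩⟩

/-- A compound term denotes a singleton, so its member on the left must be the single member on the
right. -/
theorem EqACI1.app_inj {f : F} {ss ts : Fin (ar f) → Term ar V}
    (h : EqACI1 (.app f ss) (.app f ts)) (i : Fin (ar f)) : EqACI1 (ss i) (ts i) := by
  have := (has_congr h (.inr ⟨f, ss⟩)).1 ⟨_, rfl, .refl _⟩
  obtain ⟨p, hp, h'⟩ := this
  cases hp
  cases h' with
  | mk _ h => exact h i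

theorem EqACI1.head_eq {f g : F} {ss : Fin (ar f) → Term ar V} {ts : Fin (ar g) → Term ar V}
    (h : EqACI1 (.app f ss) (.app g ts)) : f = g := by
  have := (has_congr h (.inr ⟨f, ss⟩)).1 ⟨_, rfl, .refl _⟩
  obtain ⟨p, hp, h'⟩ := this
  cases hp
  cases h' with
  | mk _ h => rfl

theorem not_eqACI1_app_empty {f : F} {ss : Fin (ar f) → Term ar V} :
    ¬ EqACI1 (.app f ss) .empty := fun h =>
  (has_congr h (.inr ⟨f, ss⟩)).1 ⟨_, rfl, .refl _⟩

end Semantics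

/-! ### Solved systems and iteration of an acyclic substitution -/

section AssocLists

variable {F : Type u} {ar : F → ℕ} {V : Type v}

theorem iterSubst_succ' (σ : Subst ar V) (n : ℕ) (X : V) :
    iterSubst σ (n + 1) X = (σ X).subst (iterSubst σ n) := by
  induction n generalizing X with
  | zero => exact (Term.subst_var _).symm
  | succ n ih =>
    change (iterSubst σ (n + 1) X).subst σ = _
    rw [ih, Term.subst_subst]
    rfl

variable [DecidableEq V]

theorem substOf_of_notMem {l : List (V × Term ar V)} {X : V} (h : X ∉ l.map Prod.fst) :
    substOf l X = .var X := by
  induction l with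
  | nil => rfl
  | cons p l ih =>
    simp only [List.map_cons, List.mem_cons, not_or] at h
    have := ih h.2
    simp only [substOf, List.lookup, beq_eq_false_iff_ne.2 h.1] at this ⊢
    exact this

theorem exists_mem_substOf {l : List (V × Term ar V)} {X : V} (h : X ∈ l.map Prod.fst) :
    (X, substOf l X) ∈ l := by
  induction l with
  | nil => simp at h
  | cons p l ih =>
    obtain ⟨Z, t⟩ := p
    by_cases hX : X = Z
    · subst hX
      simp [substOf, List.lookup]
    · have := ih (by simpa [hX] using h)
      simp only [substOf, List.lookup, beq_eq_false_iff_ne.2 hX] at this ⊢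
      exact List.mem_cons_of_mem _ this

theorem substOf_of_mem {l : List (V × Term ar V)} (hl : (l.map Prod.fst).Nodup) {X : V}
    {t : Term ar V} (h : (X, t) ∈ l) : substOf l X = t :=
  congrArg Prod.snd (List.inj_on_of_nodup_map hl
    (exists_mem_substOf (List.mem_map.2 ⟨_, h, rfl⟩)) h rfl)

/-- `τ` solves all the equations `X = t` of the list. -/
def Solves (τ : Subst ar V) (l : List (V × Term ar V)) : Prop :=
  ∀ p ∈ l, EqACI1 (τ p.1) (p.2.subst τ)

/-- A solution does not notice that variables are replaced by their right-hand sides. This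
absorption property, `ρ` followed by `τ` being `τ`, is the hypothesis under which states are
compared before and after applying `ρ`. -/
theorem Solves.substOf {τ : Subst ar V} {l : List (V × Term ar V)} (h : Solves τ l) (X : V) :
    EqACI1 ((substOf l X).subst τ) (τ X) := by
  by_cases hX : X ∈ l.map Prod.fst
  · exact (h _ (exists_mem_substOf hX)).symm
  · rw [substOf_of_notMem hX]
    exact .refl _

theorem eqACI1_subst_of_forall {ρ τ : Subst ar V} (h : ∀ X, EqACI1 ((ρ X).subst τ) (τ X))
    (t : Term ar V) : EqACI1 ((t.subst ρ).subst τ) (t.subst τ) := by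
  rw [Term.subst_subst]
  exact Term.subst_congr fun X _ => h X

theorem iterSubst_eqACI1 {σ τ : Subst ar V} (h : ∀ X, EqACI1 ((σ X).subst τ) (τ X)) (n : ℕ)
    (X : V) : EqACI1 ((iterSubst σ n X).subst τ) (τ X) := by
  induction n with
  | zero => exact .refl _
  | succ n ih => exact (eqACI1_subst_of_forall h _).trans ih

/-- `Y` occurs in the right-hand side of an equation for `X`. -/
def DependsOn (l : List (V × Term ar V)) (X Y : V) : Prop := ∃ t, (X, t) ∈ l ∧ Y ∈ t.vars

-- A key that survives `n` rounds ends a dependency chain of `n` earlier keys. By acyclicity these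
-- are distinct from each other and from the surviving key, so `n` is less than the number of keys.
open Classical in
theorem iterSubst_vars_notMem {l : List (V × Term ar V)}
    (hl : ∀ X, ¬ Relation.TransGen (DependsOn l) X X) (X Y : V)
    (hY : Y ∈ (iterSubst (substOf l) l.length X).vars) : Y ∉ l.map Prod.fst := by
  intro hkey
  -- The keys strictly above `Y`; this set grows strictly along each dependency.
  let D : V → Finset V := fun Y =>
    (l.map Prod.fst).toFinset.filter fun Z => Relation.TransGen (DependsOn l) Z Y
  have hstep : ∀ n X Y, Y ∈ l.map Prod.fst → Y ∈ (iterSubst (substOf l) n X).vars →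
      n ≤ (D Y).card := by
    intro n
    induction n with
    | zero => intros; exact Nat.zero_le _
    | succ n ih =>
      intro X Y hY hmem
      obtain ⟨Z, hZ, hYZ⟩ := Term.mem_vars_subst.1 hmem
      by_cases hZk : Z ∈ l.map Prod.fst
      · have hdep : DependsOn l Z Y := ⟨_, exists_mem_substOf hZk, hYZ⟩
        refine (ih X Z hZk hZ).trans_lt (Finset.card_lt_card ?_)
        refine (Finset.ssubset_iff_of_subset ?_).2 ⟨Z, ?_, ?_⟩
        · intro W hW
          simp only [D, Finset.mem_filter] at hW ⊢
          exact ⟨hW.1, hW.2.tail hdep⟩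
        · simp only [D, Finset.mem_filter, List.mem_toFinset]
          exact ⟨hZk, .single hdep⟩
        · simp only [D, Finset.mem_filter, not_and]
          exact fun _ => hl Z
      · rw [substOf_of_notMem hZk] at hYZ
        simp only [Term.vars, Finset.mem_singleton] at hYZ
        exact absurd (hYZ ▸ hY) hZk
  have hlt : (D Y).card < (l.map Prod.fst).toFinset.card := by
    refine Finset.card_lt_card ((Finset.ssubset_iff_of_subset (Finset.filter_subset _ _)).2
      ⟨Y, List.mem_toFinset.2 hkey, ?_⟩)
    simp only [Finset.mem_filter, not_and]
    exact fun _ => hl Y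
  have := hstep _ X Y hkey hY
  have hle := (l.map Prod.fst).toFinset_card_le
  rw [List.length_map] at hle
  omega

theorem iterSubst_of_notMem {l : List (V × Term ar V)} {X : V} (h : X ∉ l.map Prod.fst) (n : ℕ) :
    iterSubst (substOf l) n X = .var X := by
  induction n with
  | zero => rfl
  | succ n ih =>
    change (iterSubst (substOf l) n X).subst (substOf l) = _
    rw [ih, Term.subst, substOf_of_notMem h]

/-- No key is left after `l.length` rounds, so a further round changes nothing, and by
`iterSubst_succ'` that round may equally be performed first. -/
theorem iterSubst_fixed {l : List (V × Term ar V)}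
    (hl : ∀ X, ¬ Relation.TransGen (DependsOn l) X X) (X : V) :
    (substOf l X).subst (iterSubst (substOf l) l.length) = iterSubst (substOf l) l.length X := by
  rw [← iterSubst_succ', iterSubst]
  conv_rhs => rw [← Term.subst_var (iterSubst (substOf l) l.length X)]
  exact Term.subst_eq_of_vars fun Y hY => substOf_of_notMem (iterSubst_vars_notMem hl X Y hY)

/-- A substitution that is an instance of the iterated substitution solves the equations. -/
theorem solves_of_iterSubst {l : List (V × Term ar V)} (hn : (l.map Prod.fst).Nodup)
    (hl : ∀ X, ¬ Relation.TransGen (DependsOn l) X X) {τ : Subst ar V}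
    (h : ∀ X, EqACI1 ((iterSubst (substOf l) l.length X).subst τ) (τ X)) : Solves τ l := by
  rintro ⟨X, t⟩ hp
  have := iterSubst_fixed hl X
  rw [substOf_of_mem hn hp] at this
  refine (h X).symm.trans ?_
  rw [← this]
  exact eqACI1_subst_of_forall h t

theorem iterSubst_vars_subset {l : List (V × Term ar V)} {W : Finset V}
    (hl : ∀ p ∈ l, p.2.vars ⊆ W) {t : Term ar V} (ht : t.vars ⊆ W) (n : ℕ) :
    (t.subst (iterSubst (substOf l) n)).vars ⊆ W := by
  induction n with
  | zero =>
    rw [show iterSubst (substOf l) 0 = Term.var from rfl, Term.subst_var]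
    exact ht
  | succ n ih =>
    intro Y hY
    rw [show iterSubst (substOf l) (n + 1) = fun X => (iterSubst (substOf l) n X).subst (substOf l)
      from rfl, ← Term.subst_subst] at hY
    obtain ⟨X, hX, hY⟩ := Term.mem_vars_subst.1 hY
    by_cases hk : X ∈ l.map Prod.fst
    · exact hl _ (exists_mem_substOf hk) hY
    · rw [substOf_of_notMem hk, Term.vars, Finset.mem_singleton] at hY
      exact hY ▸ ih hX

end AssocLists

/-! ### The systems of `aci_step`: members, soundness, acyclicity -/

section ACIStep

variable {F : Type u} {ar : F → ℕ} {V : Type v}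

theorem argEqs_compEq {p q : Comp ar V} (h : p.1 = q.1) {τ : Subst ar V} :
    (∀ e ∈ argEqs p q, EqACI1 (e.1.subst τ) (e.2.subst τ)) ↔
      CompEq (p.subst τ) (q.subst τ) := by
  obtain ⟨f, ss⟩ := p
  obtain ⟨g, ts⟩ := q
  obtain rfl : f = g := h
  constructor
  · exact fun H => ⟨f, fun i => H _ ((mem_argEqs f).2 ⟨i, rfl⟩)⟩
  · intro H e he
    obtain ⟨i, rfl⟩ := (mem_argEqs f).1 he
    exact EqACI1.app_inj H.eqACI1 i

theorem exists_of_mem_argEqs {p q : Comp ar V} {e : Eqn ar V} (h : e ∈ argEqs p q) :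
    (∃ i, e.1 = p.2 i) ∧ ∃ i, e.2 = q.2 i := by
  obtain ⟨s, t⟩ := e
  have := List.of_mem_zip h
  simp only [List.mem_ofFn] at this
  exact ⟨this.1.imp fun _ => Eq.symm, this.2.imp fun _ => Eq.symm⟩

theorem vars_of_mem_argEqs [DecidableEq V] {p q : Comp ar V} {e : Eqn ar V} (h : e ∈ argEqs p q) :
    e.1.vars ⊆ p.toTerm.vars ∧ e.2.vars ⊆ q.toTerm.vars := by
  obtain ⟨⟨i, hi⟩, j, hj⟩ := exists_of_mem_argEqs h
  rw [hi, hj]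
  exact ⟨Finset.subset_biUnion_of_mem (fun i => (p.2 i).vars) (Finset.mem_univ i),
    Finset.subset_biUnion_of_mem (fun i => (q.2 i).vars) (Finset.mem_univ j)⟩

theorem height_of_mem_argEqs {p q : Comp ar V} {e : Eqn ar V} (h : e ∈ argEqs p q)
    (τ : Subst ar V) : (e.1.subst τ).height < (p.toTerm.subst τ).height := by
  obtain ⟨⟨i, hi⟩, -⟩ := exists_of_mem_argEqs h
  rw [hi]
  exact Term.height_arg_lt p.1 (fun i => (p.2 i).subst τ) i

theorem exists_mem_iff_exists_get {α : Type*} {l : List α} {P : α → Prop} :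
    (∃ x ∈ l, P x) ↔ ∃ i : Fin l.length, P (l.get i) := by
  simp only [List.mem_iff_get]
  exact ⟨fun ⟨_, ⟨i, hi⟩, h⟩ => ⟨i, hi ▸ h⟩, fun ⟨i, h⟩ => ⟨_, ⟨i, rfl⟩, h⟩⟩

theorem has_left {l r : Term ar V} {τ : Subst ar V} {a : V ⊕ Comp ar V} :
    Has a (l.subst τ) ↔ (∃ j, Has a (((setForm l r).P.get j).subst τ).toTerm) ∨
      (∃ j, Has a (τ ((setForm l r).L.get j))) ∨ ∃ v, Has a (τ ((setForm l r).C.get v)) := by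
  classical
  rw [has_subst, or_comm]
  refine or_congr ?_ ?_
  · rw [← exists_mem_iff_exists_get (P := fun p : Comp ar V => Has a (p.subst τ).toTerm)]
    simp [setForm]
  · rw [← exists_mem_iff_exists_get (P := fun X => Has a (τ X)),
      ← exists_mem_iff_exists_get (P := fun X => Has a (τ X))]
    simp only [setForm, List.mem_dedup, List.mem_filter, decide_eq_true_eq]
    grind

theorem has_right {l r : Term ar V} {τ : Subst ar V} {a : V ⊕ Comp ar V} :
    Has a (r.subst τ) ↔ (∃ i, Has a (((setForm l r).Q.get i).subst τ).toTerm) ∨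
      (∃ i, Has a (τ ((setForm l r).R.get i))) ∨ ∃ v, Has a (τ ((setForm l r).C.get v)) := by
  classical
  rw [has_subst, or_comm]
  refine or_congr ?_ ?_
  · rw [← exists_mem_iff_exists_get (P := fun p : Comp ar V => Has a (p.subst τ).toTerm)]
    simp [setForm]
  · rw [← exists_mem_iff_exists_get (P := fun X => Has a (τ X)),
      ← exists_mem_iff_exists_get (P := fun X => Has a (τ X))]
    simp only [setForm, List.mem_dedup, List.mem_filter, decide_eq_true_eq]
    grind

theorem get_P_mem {l r : Term ar V} (j : Fin (setForm l r).P.length) :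
    (setForm l r).P.get j ∈ l.topComps := by
  classical
  have := List.get_mem (setForm l r).P j
  simpa [setForm] using this

theorem get_Q_mem {l r : Term ar V} (i : Fin (setForm l r).Q.length) :
    (setForm l r).Q.get i ∈ r.topComps := by
  classical
  have := List.get_mem (setForm l r).Q i
  simpa [setForm] using this

namespace Guess

section

variable {e : SetEqn ar V} (B : Guess e) (A : ℕ × ℕ → V)

theorem mem_E₂ {q : Eqn ar V} :
    q ∈ B.E₂ ↔ ∃ i j, B.QP i j = true ∧ q ∈ argEqs (e.P.get j) (e.Q.get i) := by
  simp only [E₂, List.mem_flatMap, List.mem_finRange, true_and]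
  refine exists_congr fun i => exists_congr fun j => ?_
  split_ifs with h <;> simp [h]

theorem E₂_iff {τ : Subst ar V} (hB : B.NoClash) :
    (∀ q ∈ B.E₂, EqACI1 (q.1.subst τ) (q.2.subst τ)) ↔
      ∀ i j, B.QP i j = true → CompEq ((e.P.get j).subst τ) ((e.Q.get i).subst τ) := by
  constructor
  · exact fun h i j hij => (argEqs_compEq (hB i j hij)).1 fun q hq =>
      h q (B.mem_E₂.2 ⟨i, j, hij, hq⟩)
  · intro h q hq
    obtain ⟨i, j, hij, hq⟩ := B.mem_E₂.1 hq
    exact (argEqs_compEq (hB i j hij)).2 (h i j hij) q hq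

theorem has_rhsL {j : Fin e.L.length} {τ : Subst ar V} {a : V ⊕ Comp ar V} :
    Has a ((B.rhsL A j).subst τ) ↔
      (∃ i, B.QL i j = true ∧ Has a ((e.Q.get i).subst τ).toTerm) ∨
      (∃ i : Fin e.R.length, Has a (τ (A (e.Q.length + i, e.P.length + j)))) ∨
      ∃ v : Fin e.C.length, Has a (τ (A (e.Q.length + e.R.length + v, e.P.length + j))) := by
  simp only [rhsL, has_bigUnion_subst, List.mem_append, List.mem_map, List.mem_filter,
    List.mem_finRange, true_and, or_and_right, exists_or, ← Comp.toTerm_subst, or_assoc]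
  refine or_congr ?_ (or_congr ?_ ?_) <;> grind [Term.subst]

theorem has_rhsR {i : Fin e.R.length} {τ : Subst ar V} {a : V ⊕ Comp ar V} :
    Has a ((B.rhsR A i).subst τ) ↔
      (∃ j, B.RP i j = true ∧ Has a ((e.P.get j).subst τ).toTerm) ∨
      (∃ j : Fin e.L.length, Has a (τ (A (e.Q.length + i, e.P.length + j)))) ∨
      ∃ v : Fin e.C.length, Has a (τ (A (e.Q.length + i, e.P.length + e.L.length + v))) := by
  simp only [rhsR, has_bigUnion_subst, List.mem_append, List.mem_map, List.mem_filter,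
    List.mem_finRange, true_and, or_and_right, exists_or, ← Comp.toTerm_subst, or_assoc]
  refine or_congr ?_ (or_congr ?_ ?_) <;> grind [Term.subst]

theorem has_rhsC {v : Fin e.C.length} {τ : Subst ar V} {a : V ⊕ Comp ar V} :
    Has a ((B.rhsC A v).subst τ) ↔
      (∃ i, B.QC i v = true ∧ Has a ((e.Q.get i).subst τ).toTerm) ∨
      (∃ i : Fin e.R.length, Has a (τ (A (e.Q.length + i, e.P.length + e.L.length + v)))) ∨
      (∃ j, B.CP v j = true ∧ Has a ((e.P.get j).subst τ).toTerm) ∨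
      (∃ j : Fin e.L.length, Has a (τ (A (e.Q.length + e.R.length + v, e.P.length + j)))) ∨
      Has a (τ (A (e.Q.length + e.R.length + v, e.P.length + e.L.length + v))) := by
  simp only [rhsC, has_bigUnion_subst, List.mem_append, List.mem_map, List.mem_filter,
    List.mem_finRange, true_and, or_and_right, exists_or, ← Comp.toTerm_subst, or_assoc,
    List.mem_singleton]
  refine or_congr ?_ (or_congr ?_ (or_congr ?_ (or_congr ?_ ?_))) <;> grind [Term.subst]

theorem solves_E₁_iff {τ : Subst ar V} : Solves τ (B.E₁ A) ↔
    (∀ j, EqACI1 (τ (e.L.get j)) ((B.rhsL A j).subst τ)) ∧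
    (∀ i, EqACI1 (τ (e.R.get i)) ((B.rhsR A i).subst τ)) ∧
    ∀ v, EqACI1 (τ (e.C.get v)) ((B.rhsC A v).subst τ) := by
  simp only [Solves, E₁, List.mem_append, List.mem_ofFn, or_imp, forall_and, and_assoc,
    forall_exists_index, forall_apply_eq_imp_iff]

/-- The positions of the new variables. -/
def box (e : SetEqn ar V) : Finset (ℕ × ℕ) :=
  Finset.range (e.Q.length + e.R.length + e.C.length) ×ˢ
    Finset.range (e.P.length + e.L.length + e.C.length)

/-- At the top level of the right-hand sides only new variables occur; old ones sit inside compound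
terms, where depth drops. -/
theorem E₁_topVars {X Y : V} {t : Term ar V} (h : (X, t) ∈ B.E₁ A) (hY : Y ∈ t.topVars) :
    ∃ p ∈ box e, Y = A p := by
  simp only [E₁, List.mem_append, List.mem_ofFn, Prod.mk.injEq] at h
  obtain (⟨j, -, rfl⟩ | ⟨i, -, rfl⟩) | ⟨v, -, rfl⟩ := h
  all_goals
    simp only [rhsL, rhsR, rhsC, mem_topVars_bigUnion, List.mem_append, List.mem_map,
      List.mem_singleton] at hY
    obtain ⟨t, h, hY⟩ := hY
  · obtain (⟨i, -, rfl⟩ | ⟨i, -, rfl⟩) | ⟨v, -, rfl⟩ := h <;>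
      simp only [Comp.toTerm, Term.topVars, List.not_mem_nil, List.mem_singleton] at hY
    · exact ⟨_, by simp [box]; omega, hY⟩
    · exact ⟨_, by simp [box]; omega, hY⟩
  · obtain (⟨i, -, rfl⟩ | ⟨i, -, rfl⟩) | ⟨v, -, rfl⟩ := h <;>
      simp only [Comp.toTerm, Term.topVars, List.not_mem_nil, List.mem_singleton] at hY
    · exact ⟨_, by simp [box]; omega, hY⟩
    · exact ⟨_, by simp [box]; omega, hY⟩
  · obtain (((⟨i, -, rfl⟩ | ⟨i, -, rfl⟩) | ⟨j, -, rfl⟩) | ⟨j, -, rfl⟩) | rfl := h <;>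
      simp only [Comp.toTerm, Term.topVars, List.not_mem_nil, List.mem_singleton] at hY
    · exact ⟨_, by simp [box]; omega, hY⟩
    · exact ⟨_, by simp [box]; omega, hY⟩
    · exact ⟨_, by simp [box], hY⟩

theorem E₁_topComps {X : V} {p : Comp ar V} {t : Term ar V} (h : (X, t) ∈ B.E₁ A)
    (hp : p ∈ t.topComps) : (∃ j, p = e.P.get j) ∨ ∃ i, p = e.Q.get i := by
  simp only [E₁, List.mem_append, List.mem_ofFn, Prod.mk.injEq] at h
  obtain (⟨j, -, rfl⟩ | ⟨i, -, rfl⟩) | ⟨v, -, rfl⟩ := h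
  all_goals
    simp only [rhsL, rhsR, rhsC, mem_topComps_bigUnion, List.mem_append, List.mem_map,
      List.mem_singleton] at hp
    obtain ⟨t, h, hp⟩ := hp
  · obtain (⟨i, -, rfl⟩ | ⟨i, -, rfl⟩) | ⟨v, -, rfl⟩ := h <;>
      simp only [Comp.toTerm, Term.topComps, List.not_mem_nil, List.mem_singleton] at hp
    exact .inr ⟨i, hp⟩
  · obtain (⟨i, -, rfl⟩ | ⟨i, -, rfl⟩) | ⟨v, -, rfl⟩ := h <;>
      simp only [Comp.toTerm, Term.topComps, List.not_mem_nil, List.mem_singleton] at hp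
    exact .inl ⟨i, hp⟩
  · obtain (((⟨i, -, rfl⟩ | ⟨i, -, rfl⟩) | ⟨j, -, rfl⟩) | ⟨j, -, rfl⟩) | rfl := h <;>
      simp only [Comp.toTerm, Term.topComps, List.not_mem_nil, List.mem_singleton] at hp
    · exact .inr ⟨i, hp⟩
    · exact .inl ⟨j, hp⟩

theorem E₁_keys : (B.E₁ A).map Prod.fst = e.L ++ e.R ++ e.C := by
  simp only [E₁, List.map_append, List.map_ofFn, Function.comp_def, List.ofFn_get]

end

section

variable {l r : Term ar V} {B : Guess (setForm l r)} {A : ℕ × ℕ → V}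

theorem mem_E₁_keys {X : V} :
    X ∈ (B.E₁ A).map Prod.fst ↔ X ∈ l.topVars ∨ X ∈ r.topVars := by
  classical
  rw [E₁_keys]
  simp only [setForm, List.mem_append, List.mem_dedup, List.mem_filter, decide_eq_true_eq]
  tauto

theorem E₁_keys_nodup : ((B.E₁ A).map Prod.fst).Nodup := by
  classical
  rw [E₁_keys]
  simp only [setForm, List.nodup_append, List.nodup_dedup, List.mem_dedup, List.mem_append,
    List.mem_filter, decide_eq_true_eq, true_and]
  grind

/-- Soundness of `aci_step`. -/
theorem eqACI1_of_solves {τ : Subst ar V} (h₁ : Solves τ (B.E₁ A))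
    (h₂ : ∀ i j, B.QP i j = true →
      CompEq (((setForm l r).P.get j).subst τ) (((setForm l r).Q.get i).subst τ)) :
    EqACI1 (l.subst τ) (r.subst τ) := by
  obtain ⟨hL, hR, hC⟩ := (B.solves_E₁_iff A).1 h₁
  rw [eqACI1_iff]
  intro a
  have hL' := fun j => (has_congr (hL j) a).trans (B.has_rhsL A)
  have hR' := fun i => (has_congr (hR i) a).trans (B.has_rhsR A)
  have hC' := fun v => (has_congr (hC v) a).trans (B.has_rhsC A)
  rw [has_left (r := r), has_right (l := l)]
  constructor
  · rintro (⟨j, hj⟩ | ⟨j, hj⟩ | ⟨v, hv⟩)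
    -- The column of `p_j` has a bit 1, and the row of that bit receives `p_j` on the other side.
    · obtain ⟨i, hi⟩ | ⟨i, hi⟩ | ⟨v, hv⟩ := B.col j
      · exact .inl ⟨i, (has_congr (h₂ i j hi).eqACI1 a).1 hj⟩
      · exact .inr (.inl ⟨i, (hR' i).2 (.inl ⟨j, hi, hj⟩)⟩)
      · exact .inr (.inr ⟨v, (hC' v).2 (.inr (.inr (.inl ⟨j, hv, hj⟩)))⟩)
    -- A member of `L_j` comes from some position of its column, hence also lies in the row of that
    -- position.
    · obtain ⟨i, -, hi⟩ | ⟨i, hi⟩ | ⟨v, hv⟩ := (hL' j).1 hj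
      · exact .inl ⟨i, hi⟩
      · exact .inr (.inl ⟨i, (hR' i).2 (.inr (.inl ⟨j, hi⟩))⟩)
      · exact .inr (.inr ⟨v, (hC' v).2 (.inr (.inr (.inr (.inl ⟨j, hv⟩))))⟩)
    · exact .inr (.inr ⟨v, hv⟩)
  · rintro (⟨i, hi⟩ | ⟨i, hi⟩ | ⟨v, hv⟩)
    · obtain ⟨j, hj⟩ | ⟨j, hj⟩ | ⟨v, hv⟩ := B.row i
      · exact .inl ⟨j, (has_congr (h₂ i j hj).eqACI1 a).2 hi⟩
      · exact .inr (.inl ⟨j, (hL' j).2 (.inl ⟨i, hj, hi⟩)⟩)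
      · exact .inr (.inr ⟨v, (hC' v).2 (.inl ⟨i, hv, hi⟩)⟩)
    · obtain ⟨j, -, hj⟩ | ⟨j, hj⟩ | ⟨v, hv⟩ := (hR' i).1 hi
      · exact .inl ⟨j, hj⟩
      · exact .inr (.inl ⟨j, (hL' j).2 (.inr (.inl ⟨i, hj⟩))⟩)
      · exact .inr (.inr ⟨v, (hC' v).2 (.inr (.inl ⟨i, hv⟩))⟩)
    · exact .inr (.inr ⟨v, hv⟩)

/-- An assignment that solves `E₁` excludes cycles. -/
theorem acyclic_of_solves [DecidableEq V] {τ : Subst ar V} (h : Solves τ (B.E₁ A))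
    (hA : ∀ p, A p ∉ l.vars ∧ A p ∉ r.vars) : B.Acyclic A := by
  have hkey : ∀ {X Y}, B.Dep A X Y → ∀ p, X ≠ A p := by
    rintro X Y ⟨t, ht, -⟩ p rfl
    rcases mem_E₁_keys.1 (List.mem_map.2 ⟨_, ht, rfl⟩) with h | h
    · exact (hA p).1 (Term.mem_vars_iff.2 (.inl h))
    · exact (hA p).2 (Term.mem_vars_iff.2 (.inl h))
  -- A dependency leads to a new variable, which has no equation and so no successor, or to a value
  -- of smaller depth. A cycle could use only the second kind.
  have hdep : ∀ {X Y}, B.Dep A X Y → (∃ p, Y = A p) ∨ (τ Y).height < (τ X).height := by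
    rintro X Y ⟨t, ht, hY⟩
    rcases Term.mem_vars_iff.1 hY with hY | ⟨p, hp, hY⟩
    · obtain ⟨p, -, hp⟩ := B.E₁_topVars A ht hY
      exact .inl ⟨p, hp⟩
    · right
      rw [Term.height_congr (h _ ht)]
      exact Term.height_var_lt_topComp hp hY
  intro X hX
  have hmain : ∀ {Y}, Relation.TransGen (B.Dep A) X Y →
      (∃ p, Y = A p) ∨ (τ Y).height < (τ X).height := by
    intro Y hXY
    induction hXY with
    | single h => exact hdep h
    | tail _ hYZ ih =>
      rcases ih with ⟨p, hp⟩ | ih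
      · exact absurd hp (hkey hYZ p)
      · exact (hdep hYZ).imp_right fun h => h.trans ih
  rcases hmain hX with ⟨p, hp⟩ | h
  · obtain ⟨Y, hY, -⟩ := Relation.TransGen.head'_iff.1 hX
    exact hkey hY p hp
  · exact lt_irrefl _ h

end

end Guess

end ACIStep

/-! ### Completeness of `aci_step` -/

section Completeness

variable {F : Type u} {ar : F → ℕ} {V : Type v}

namespace SetEqn

/-- The value of the variable that labels the `n`-th row. -/
def rowValue (e : SetEqn ar V) (σ : Subst ar V) (n : ℕ) : Term ar V :=
  -- In rows of compound terms the truncated subtraction yields an arbitrary value; it is harmless,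
  -- as `E₁` uses no new variable of such a row. Likewise for columns.
  ((e.R ++ e.C)[n - e.Q.length]?).elim .empty σ

/-- The value of the variable that labels the `n`-th column. -/
def colValue (e : SetEqn ar V) (σ : Subst ar V) (n : ℕ) : Term ar V :=
  ((e.L ++ e.C)[n - e.P.length]?).elim .empty σ

variable {e : SetEqn ar V} {σ : Subst ar V}

theorem rowValue_R (i : Fin e.R.length) : e.rowValue σ (e.Q.length + i) = σ (e.R.get i) := by
  simp [rowValue, List.getElem?_append_left i.2]

theorem rowValue_C (v : Fin e.C.length) :
    e.rowValue σ (e.Q.length + e.R.length + v) = σ (e.C.get v) := by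
  simp [rowValue, add_assoc]

theorem colValue_L (j : Fin e.L.length) : e.colValue σ (e.P.length + j) = σ (e.L.get j) := by
  simp [colValue, List.getElem?_append_left j.2]

theorem colValue_C (v : Fin e.C.length) :
    e.colValue σ (e.P.length + e.L.length + v) = σ (e.C.get v) := by
  simp [colValue, add_assoc]

end SetEqn

theorem setForm_get_mem (l r : Term ar V) :
    (∀ j, (setForm l r).L.get j ∈ l.topVars) ∧ (∀ i, (setForm l r).R.get i ∈ r.topVars) ∧
      ∀ v, (setForm l r).C.get v ∈ l.topVars := by
  classical
  refine ⟨fun j => ?_, fun i => ?_, fun v => ?_⟩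
  · have := List.get_mem (setForm l r).L j
    exact (List.mem_filter.1 (List.mem_dedup.1 this)).1
  · have := List.get_mem (setForm l r).R i
    exact (List.mem_filter.1 (List.mem_dedup.1 this)).1
  · have := List.get_mem (setForm l r).C v
    exact (List.mem_filter.1 (List.mem_dedup.1 this)).1

theorem subst_extend [DecidableEq V] {A : ℕ × ℕ → V} {g : ℕ × ℕ → Term ar V} {σ : Subst ar V}
    {t : Term ar V} (h : ∀ p, A p ∉ t.vars) : t.subst (Function.extend A g σ) = t.subst σ :=
  Term.subst_eq_of_vars fun _ hX => Function.extend_apply' _ _ _ fun ⟨p, hp⟩ => h p (hp ▸ hX)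

open Classical in
/-- Completeness of `aci_step`: a unifier determines a guess, and it extends to the new variables
as a solution of the two systems. -/
theorem exists_guess [DecidableEq V] {l r : Term ar V} {σ : Subst ar V}
    (h : EqACI1 (l.subst σ) (r.subst σ)) {A : ℕ × ℕ → V} (hA : Function.Injective A)
    (hl : ∀ p, A p ∉ l.vars) (hr : ∀ p, A p ∉ r.vars) :
    ∃ B : Guess (setForm l r), B.NoClash ∧ ∃ τ : Subst ar V,
      (∀ X, (∀ p, A p ≠ X) → τ X = σ X) ∧ Solves τ (B.E₁ A) ∧
      ∀ i j, B.QP i j = true →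
        CompEq (((setForm l r).P.get j).subst τ) (((setForm l r).Q.get i).subst τ) := by
  have hlr := has_congr h
  have hself : ∀ p : Comp ar V, Has (.inr p) p.toTerm := fun p => ⟨p, rfl, .refl p⟩
  have hcomp : ∀ {a p} {t : Term ar V}, Has a (Comp.toTerm p) → (Has a t ↔ Has (.inr p) t) := by
    rintro a p t ⟨q, rfl, hq⟩
    exact has_of_compEq hq t
  have hleft := fun a => has_left (l := l) (r := r) (τ := σ) (a := a)
  have hright := fun a => has_right (l := l) (r := r) (τ := σ) (a := a)
  obtain ⟨hmL, hmR, hmC⟩ := setForm_get_mem l r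
  have hP : ∀ j, ∀ p, A p ∉ ((setForm l r).P.get j).toTerm.vars := fun j p hp =>
    hl p (Term.mem_vars_iff.2 (.inr ⟨_, get_P_mem j, hp⟩))
  have hQ : ∀ i, ∀ p, A p ∉ ((setForm l r).Q.get i).toTerm.vars := fun i p hp =>
    hr p (Term.mem_vars_iff.2 (.inr ⟨_, get_Q_mem i, hp⟩))
  have hlt : ∀ X ∈ l.topVars, ∀ p, A p ≠ X := fun X hX p hp =>
    hl p (Term.mem_vars_iff.2 (.inl (hp ▸ hX)))
  have hrt : ∀ X ∈ r.topVars, ∀ p, A p ≠ X := fun X hX p hp =>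
    hr p (Term.mem_vars_iff.2 (.inl (hp ▸ hX)))
  generalize setForm l r = e at *
  -- The guess records which equalities and memberships hold under `σ`. A row or column has a bit 1
  -- because its instantiated compound term is a member of both sides.
  let B : Guess e :=
    { QP := fun i j => decide (CompEq ((e.P.get j).subst σ) ((e.Q.get i).subst σ))
      QL := fun i j => decide (Has (.inr ((e.Q.get i).subst σ)) (σ (e.L.get j)))
      QC := fun i v => decide (Has (.inr ((e.Q.get i).subst σ)) (σ (e.C.get v)))
      RP := fun i j => decide (Has (.inr ((e.P.get j).subst σ)) (σ (e.R.get i)))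
      CP := fun v j => decide (Has (.inr ((e.P.get j).subst σ)) (σ (e.C.get v)))
      row := by
        intro i
        simp only [decide_eq_true_eq]
        rcases (hleft _).1 ((hlr _).2 ((hright _).2 (.inl ⟨i, hself _⟩))) with
          ⟨j, p, hp, hpq⟩ | h | h
        · cases hp
          exact .inl ⟨j, hpq.symm⟩
        · exact .inr (.inl h)
        · exact .inr (.inr h)
      col := by
        intro j
        simp only [decide_eq_true_eq]
        rcases (hright _).1 ((hlr _).1 ((hleft _).2 (.inl ⟨j, hself _⟩))) with
          ⟨i, p, hp, hpq⟩ | h | h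
        · cases hp
          exact .inl ⟨i, hpq⟩
        · exact .inr (.inl h)
        · exact .inr (.inr h) }
  -- `σ` on old variables; on a new variable, what its row and its column have in common.
  let τ : Subst ar V :=
    Function.extend A (fun p => inter (e.rowValue σ p.1) (e.colValue σ p.2)) σ
  have hτP : ∀ j, ((e.P.get j).subst τ).toTerm = ((e.P.get j).subst σ).toTerm :=
    fun j => subst_extend (hP j)
  have hτQ : ∀ i, ((e.Q.get i).subst τ).toTerm = ((e.Q.get i).subst σ).toTerm :=
    fun i => subst_extend (hQ i)
  have hτ : ∀ X, (∀ p, A p ≠ X) → τ X = σ X := fun X hX =>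
    Function.extend_apply' _ _ _ fun ⟨p, hp⟩ => hX p hp
  have hτA : ∀ m n a, Has a (τ (A (m, n))) ↔ Has a (e.rowValue σ m) ∧ Has a (e.colValue σ n) := by
    intro m n a
    rw [show τ (A (m, n)) = _ from hA.extend_apply _ _ _, has_inter]
  refine ⟨B, ?_, τ, hτ, (B.solves_E₁_iff A).2 ⟨fun j => ?_, fun i => ?_, fun v => ?_⟩, ?_⟩
  · intro i j hij
    have hij : CompEq ((e.P.get j).subst σ) ((e.Q.get i).subst σ) := of_decide_eq_true hij
    exact EqACI1.head_eq hij.eqACI1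
  · rw [eqACI1_iff]
    intro a
    rw [B.has_rhsL, hτ _ (hlt _ (hmL j))]
    simp only [hτA, SetEqn.rowValue_R, SetEqn.rowValue_C, SetEqn.colValue_L, hτQ, B,
      decide_eq_true_eq]
    constructor
    · intro ha
      -- A member of `L_j` is a member of the right side, hence of some row, and the position in
      -- that row catches it. If the row is a compound term, that term is the member itself, so the
      -- bit is 1.
      rcases (hright _).1 ((hlr _).1 ((hleft _).2 (.inr (.inl ⟨j, ha⟩)))) with
        ⟨i, hi⟩ | ⟨i, hi⟩ | ⟨v, hv⟩
      · exact .inl ⟨i, (hcomp hi).1 ha, hi⟩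
      · exact .inr (.inl ⟨i, hi, ha⟩)
      · exact .inr (.inr ⟨v, hv, ha⟩)
    · rintro (⟨i, hi, ha⟩ | ⟨i, -, ha⟩ | ⟨v, -, ha⟩)
      · exact (hcomp ha).2 hi
      · exact ha
      · exact ha
  · rw [eqACI1_iff]
    intro a
    rw [B.has_rhsR, hτ _ (hrt _ (hmR i))]
    simp only [hτA, SetEqn.rowValue_R, SetEqn.colValue_C, SetEqn.colValue_L, hτP, B,
      decide_eq_true_eq]
    constructor
    · intro ha
      rcases (hleft _).1 ((hlr _).2 ((hright _).2 (.inr (.inl ⟨i, ha⟩)))) with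
        ⟨j, hj⟩ | ⟨j, hj⟩ | ⟨v, hv⟩
      · exact .inl ⟨j, (hcomp hj).1 ha, hj⟩
      · exact .inr (.inl ⟨j, ha, hj⟩)
      · exact .inr (.inr ⟨v, ha, hv⟩)
    · rintro (⟨j, hj, ha⟩ | ⟨j, ha, -⟩ | ⟨v, ha, -⟩)
      · exact (hcomp ha).2 hj
      · exact ha
      · exact ha
  · rw [eqACI1_iff]
    intro a
    rw [B.has_rhsC, hτ _ (hlt _ (hmC v))]
    simp only [hτA, SetEqn.rowValue_R, SetEqn.rowValue_C, SetEqn.colValue_C, SetEqn.colValue_L,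
      hτP, hτQ, B, decide_eq_true_eq]
    constructor
    -- The diagonal position takes the whole value of the common variable; positions of two
    -- different common variables are therefore dispensable.
    · exact fun ha => .inr (.inr (.inr (.inr ⟨ha, ha⟩)))
    · rintro (⟨i, hi, ha⟩ | ⟨i, -, ha⟩ | ⟨j, hj, ha⟩ | ⟨j, ha, -⟩ | ⟨ha, -⟩)
      · exact (hcomp ha).2 hi
      · exact ha
      · exact (hcomp ha).2 hj
      · exact ha
      · exact ha
  · intro i j hij
    have hij : CompEq ((e.P.get j).subst σ) ((e.Q.get i).subst σ) := of_decide_eq_true hij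
    have hp : (e.P.get j).subst τ = (e.P.get j).subst σ := by
      have := hτP j
      simp only [Comp.toTerm, Term.app.injEq] at this
      exact Sigma.ext this.1 this.2
    have hq : (e.Q.get i).subst τ = (e.Q.get i).subst σ := by
      have := hτQ i
      simp only [Comp.toTerm, Term.app.injEq] at this
      exact Sigma.ext this.1 this.2
    rwa [hp, hq]

end Completeness

/-! ### Soundness of a step and the invariant of states -/

section Procedure

variable {F : Type u} {ar : F → ℕ} {V : Type v}

theorem Choice.perm {s : State ar V} (c : Choice s) : (c.eqn :: c.rest).Perm s.pending :=
  List.getElem_cons_eraseIdx_perm c.idx.2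

theorem Choice.eqn_mem {s : State ar V} (c : Choice s) : c.eqn ∈ s.pending :=
  c.perm.subset List.mem_cons_self

theorem Choice.mem_of_mem_rest {s : State ar V} (c : Choice s) {e : Eqn ar V} (h : e ∈ c.rest) :
    e ∈ s.pending := c.perm.subset (List.mem_cons_of_mem _ h)

/-- `τ` unifies all the equations of the state. -/
structure State.Sat (s : State ar V) (τ : Subst ar V) : Prop where
  solved : Solves τ s.solved
  pending : IsUnifier s.pending τ

theorem Choice.isUnifier_iff {s : State ar V} (c : Choice s) {τ : Subst ar V} :
    IsUnifier s.pending τ ↔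
      EqACI1 (c.eqn.1.subst τ) (c.eqn.2.subst τ) ∧ IsUnifier c.rest τ := by
  simp only [IsUnifier, ← c.perm.mem_iff, List.forall_mem_cons]

theorem isUnifier_cons {e : Eqn ar V} {E : List (Eqn ar V)} {τ : Subst ar V} :
    IsUnifier (e :: E) τ ↔ EqACI1 (e.1.subst τ) (e.2.subst τ) ∧ IsUnifier E τ :=
  List.forall_mem_cons

theorem isUnifier_append {E E' : List (Eqn ar V)} {τ : Subst ar V} :
    IsUnifier (E ++ E') τ ↔ IsUnifier E τ ∧ IsUnifier E' τ :=
  List.forall_mem_append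

theorem isUnifier_argEqs {f : F} {ss ts : Fin (ar f) → Term ar V} {τ : Subst ar V} :
    IsUnifier (argEqs ⟨f, ss⟩ ⟨f, ts⟩) τ ↔
      EqACI1 (Term.subst τ (.app f ss)) (Term.subst τ (.app f ts)) := by
  refine (argEqs_compEq (p := (⟨f, ss⟩ : Comp ar V)) (q := ⟨f, ts⟩) rfl).trans ?_
  exact ⟨CompEq.eqACI1, fun h => ⟨f, EqACI1.app_inj h⟩⟩

theorem isUnifier_map_subst [DecidableEq V] {ρ τ : Subst ar V}
    (h : ∀ X, EqACI1 ((ρ X).subst τ) (τ X)) {E : List (Eqn ar V)} :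
    IsUnifier (E.map (Eqn.subst ρ)) τ ↔ IsUnifier E τ := by
  simp only [IsUnifier, List.forall_mem_map, Eqn.subst]
  refine forall₂_congr fun e _ => ⟨fun H => ?_, fun H => ?_⟩
  · exact (eqACI1_subst_of_forall h _).symm.trans (H.trans (eqACI1_subst_of_forall h _))
  · exact (eqACI1_subst_of_forall h _).trans (H.trans (eqACI1_subst_of_forall h _).symm)

theorem solves_substSolved [DecidableEq V] {ρ τ : Subst ar V}
    (h : ∀ X, EqACI1 ((ρ X).subst τ) (τ X)) {l : List (V × Term ar V)} :
    Solves τ (substSolved ρ l) ↔ Solves τ l := by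
  simp only [Solves, substSolved, List.forall_mem_map]
  refine forall₂_congr fun e _ => ⟨fun H => ?_, fun H => ?_⟩
  · exact H.trans (eqACI1_subst_of_forall h _)
  · exact H.trans (eqACI1_subst_of_forall h _).symm

theorem has_absorb_subst [DecidableEq V] {t : Term ar V} {X N : V} {τ : Subst ar V}
    {a : V ⊕ Comp ar V} :
    Has a ((bigUnion (t.topComps.map Comp.toTerm ++
        (t.topVars.filter (fun Y => Y ≠ X)).map .var ++ [.var N])).subst τ) ↔
      (∃ p ∈ t.topComps, Has a (p.subst τ).toTerm) ∨
        (∃ Y ∈ t.topVars, Y ≠ X ∧ Has a (τ Y)) ∨ Has a (τ N) := by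
  simp only [has_bigUnion_subst, List.mem_append, List.mem_map, List.mem_filter,
    decide_eq_true_eq, or_and_right, exists_or, or_assoc, List.mem_singleton,
    ← Comp.toTerm_subst]
  refine or_congr ?_ (or_congr ?_ ?_) <;> grind [Term.subst]

theorem map_fst_substSolved (σ : Subst ar V) (l : List (V × Term ar V)) :
    (substSolved σ l).map Prod.fst = l.map Prod.fst := by
  simp [substSolved]

variable [DecidableEq V]

theorem substOf_singleton_eqACI1 {X : V} {t : Term ar V} {τ : Subst ar V}
    (h : EqACI1 (τ X) (t.subst τ)) (Y : V) : EqACI1 ((substOf [(X, t)] Y).subst τ) (τ Y) :=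
  Solves.substOf (by simpa [Solves] using h) Y

/-- Every unifier of the new state is a unifier of the old one. -/
theorem Step.sat {s s' : State ar V} {c : Choice s} (h : Step s c s') {τ : Subst ar V}
    (hτ : s'.Sat τ) : s.Sat τ := by
  obtain ⟨hs, hp⟩ := hτ
  cases h with
  | trivial X h => exact ⟨hs, c.isUnifier_iff.2 ⟨by rw [h]; exact .refl _, hp⟩⟩
  | orient t X h ht =>
    rw [isUnifier_cons] at hp
    exact ⟨hs, c.isUnifier_iff.2 ⟨by rw [h]; exact hp.1.symm, hp.2⟩⟩
  | bind X t h hX =>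
    have hXt : EqACI1 (τ X) (t.subst τ) := hs _ List.mem_cons_self
    have hρ := substOf_singleton_eqACI1 hXt
    refine ⟨(solves_substSolved hρ).1 fun p hp => hs p (List.mem_cons_of_mem _ hp),
      c.isUnifier_iff.2 ⟨by rw [h]; exact hXt, (isUnifier_map_subst hρ).1 hp⟩⟩
  | absorb X t h ht hX hX' =>
    rw [isUnifier_cons] at hp
    refine ⟨hs, c.isUnifier_iff.2 ⟨?_, hp.2⟩⟩
    rw [h, eqACI1_iff]
    intro a
    have ha := has_congr hp.1 a
    simp only [Term.subst, has_absorb_subst] at ha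
    simp only [Term.subst, has_subst]
    -- By the new equation the parts of `t` other than `X` are included in `X`, so adding them to
    -- `X` changes nothing.
    constructor
    · exact fun h => .inl ⟨X, hX, h⟩
    · rintro (⟨Y, hY, h⟩ | h)
      · by_cases hYX : Y = X
        · exact hYX ▸ h
        · exact ha.2 (.inr (.inl ⟨Y, hY, hYX, h⟩))
      · exact ha.2 (.inl h)
  | decompose f ss ts h =>
    rw [isUnifier_append, isUnifier_argEqs] at hp
    exact ⟨hs, c.isUnifier_iff.2 ⟨by rw [h]; exact hp.1, hp.2⟩⟩
  | decompose_empty h => exact ⟨hs, c.isUnifier_iff.2 ⟨by rw [h]; exact .refl _, hp⟩⟩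
  | aciStep l r h hl hr hlr B hB hB' =>
    -- The new solved list contains `X = ρ(X)` for each key of `E₁`, and `ρ` fixes all other
    -- variables.
    have hρ : ∀ X, EqACI1 ((B.rho c.fresh X).subst τ) (τ X) := by
      intro X
      by_cases hX : X ∈ (B.E₁ c.fresh).map Prod.fst
      · obtain ⟨p, hp, rfl⟩ := List.mem_map.1 hX
        exact (hs (p.1, B.rho c.fresh p.1) (List.mem_map.2 ⟨(p.1, .var p.1),
          List.mem_append_right _ (List.mem_map.2 ⟨p, hp, rfl⟩), rfl⟩)).symm
      · rw [Guess.rho, iterSubst_of_notMem hX]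
        exact .refl _
    have hp' := (isUnifier_map_subst hρ).1 hp
    rw [isUnifier_append] at hp'
    refine ⟨fun p hp => (solves_substSolved hρ).1 hs p (List.mem_append_left _ hp),
      c.isUnifier_iff.2 ⟨?_, hp'.2⟩⟩
    rw [h]
    exact Guess.eqACI1_of_solves (solves_of_iterSubst Guess.E₁_keys_nodup hB' hρ)
      ((B.E₂_iff hB).1 hp'.1)

/-- The variables of the term have been used, and they are not solved. -/
def State.Clean (s : State ar V) (t : Term ar V) : Prop :=
  ∀ Y ∈ t.vars, Y ∈ s.used ∧ Y ∉ s.solved.map Prod.fst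

/-- The solved variables are distinct and occur nowhere else. -/
structure State.WF (s : State ar V) : Prop where
  nodup : (s.solved.map Prod.fst).Nodup
  key_used : ∀ X ∈ s.solved.map Prod.fst, X ∈ s.used
  solved_clean : ∀ p ∈ s.solved, s.Clean p.2
  pending_clean : ∀ e ∈ s.pending, s.Clean e.1 ∧ s.Clean e.2

theorem Step.used_subset {s s' : State ar V} {c : Choice s} (h : Step s c s') :
    s.used ⊆ s'.used := by
  cases h with
  | absorb => exact Finset.subset_insert _ _
  | aciStep => exact Finset.subset_union_left
  | _ => exact Finset.Subset.refl _

theorem mem_vars_subst_singleton {X Y : V} {t u : Term ar V} (hX : X ∉ t.vars)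
    (hY : Y ∈ (u.subst (substOf [(X, t)])).vars) : (Y ∈ t.vars ∨ Y ∈ u.vars) ∧ Y ≠ X := by
  obtain ⟨Z, hZ, hY⟩ := Term.mem_vars_subst.1 hY
  by_cases hZX : Z = X
  · subst hZX
    rw [substOf_of_mem (by simp) (List.mem_singleton.2 rfl)] at hY
    exact ⟨.inl hY, fun h => hX (h ▸ hY)⟩
  · rw [substOf_of_notMem (by simpa using hZX), Term.vars, Finset.mem_singleton] at hY
    subst hY
    exact ⟨.inr hZ, hZX⟩

theorem mem_vars_absorb {t : Term ar V} {X N Y : V}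
    (h : Y ∈ (bigUnion (t.topComps.map Comp.toTerm ++
      (t.topVars.filter (fun Y => Y ≠ X)).map .var ++ [.var N])).vars) : Y ∈ t.vars ∨ Y = N := by
  rw [Term.mem_vars_iff, mem_topVars_bigUnion] at h
  simp only [mem_topComps_bigUnion, List.mem_append, List.mem_map, List.mem_filter,
    List.mem_singleton] at h
  rcases h with ⟨u, (⟨p, hp, rfl⟩ | ⟨Z, ⟨hZ, -⟩, rfl⟩) | rfl, hY⟩ |
    ⟨q, ⟨u, (⟨p, hp, rfl⟩ | ⟨Z, ⟨hZ, -⟩, rfl⟩) | rfl, hq⟩, hY⟩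
  · simp [Comp.toTerm, Term.topVars] at hY
  · simp only [Term.topVars, List.mem_singleton] at hY
    exact .inl (Term.mem_vars_iff.2 (.inl (hY ▸ hZ)))
  · simp only [Term.topVars, List.mem_singleton] at hY
    exact .inr hY
  · simp only [Comp.toTerm, Term.topComps, List.mem_singleton] at hq
    subst hq
    exact .inl (Term.mem_vars_iff.2 (.inr ⟨_, hp, hY⟩))
  · simp [Term.topComps] at hq
  · simp [Term.topComps] at hq

/-- This makes the rank drop: an equation produced by absorption is not ready for another
absorption. -/
theorem notMem_topVars_absorb {t : Term ar V} {X N : V} (hN : N ≠ X) :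
    X ∉ (bigUnion (t.topComps.map Comp.toTerm ++
      (t.topVars.filter (fun Y => Y ≠ X)).map .var ++ [.var N])).topVars := by
  simp only [mem_topVars_bigUnion, List.mem_append, List.mem_map, List.mem_filter,
    List.mem_singleton]
  rintro ⟨u, (⟨p, hp, rfl⟩ | ⟨Z, ⟨-, hZ⟩, rfl⟩) | rfl, hX⟩
  · simp [Comp.toTerm, Term.topVars] at hX
  · simp only [Term.topVars, List.mem_singleton] at hX
    simp [hX] at hZ
  · simp only [Term.topVars, List.mem_singleton] at hX
    exact hN hX.symm

theorem Step.wf {s s' : State ar V} {c : Choice s} (h : Step s c s') (hs : s.WF) : s'.WF := by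
  obtain ⟨hn, hk, hsc, hpc⟩ := hs
  have hc := hpc _ c.eqn_mem
  have hrest := fun e he => hpc e (c.mem_of_mem_rest he)
  cases h with
  | trivial X h => exact ⟨hn, hk, hsc, hrest⟩
  | orient t X h ht =>
    rw [h] at hc
    exact ⟨hn, hk, hsc, List.forall_mem_cons.2 ⟨hc.symm, hrest⟩⟩
  | bind X t h hX =>
    rw [h] at hc
    have hXc := hc.1 X (by simp [Term.vars])
    have hkeys : ((X, t) :: substSolved (substOf [(X, t)]) s.solved).map Prod.fst =
        X :: s.solved.map Prod.fst := by rw [List.map_cons, map_fst_substSolved]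
    have hclean : ∀ u, s.Clean u → ∀ Y ∈ (u.subst (substOf [(X, t)])).vars,
        Y ∈ s.used ∧ Y ∉ X :: s.solved.map Prod.fst := by
      intro u hu Y hY
      obtain ⟨h, hne⟩ := mem_vars_subst_singleton hX hY
      have := h.elim (hc.2 Y) (hu Y)
      exact ⟨this.1, by simpa only [List.mem_cons, not_or] using ⟨hne, this.2⟩⟩
    refine ⟨?_, ?_, ?_, ?_⟩
    · rw [hkeys]
      exact List.nodup_cons.2 ⟨hXc.2, hn⟩
    · rw [hkeys]
      exact List.forall_mem_cons.2 ⟨hXc.1, hk⟩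
    · simp only [State.Clean, hkeys]
      refine List.forall_mem_cons.2 ⟨fun Y hY => ?_, ?_⟩
      · have := hc.2 Y hY
        refine ⟨this.1, List.not_mem_cons_of_ne_of_not_mem ?_ this.2⟩
        rintro rfl
        exact hX hY
      · simp only [substSolved, List.forall_mem_map]
        exact fun p hp => hclean _ (hsc p hp)
    · simp only [State.Clean, hkeys, List.forall_mem_map]
      exact fun e he => ⟨hclean _ (hrest e he).1, hclean _ (hrest e he).2⟩
  | absorb X t h ht hX hX' =>
    rw [h] at hc
    have hmono : ∀ u, s.Clean u → ∀ Y ∈ u.vars,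
        Y ∈ insert (c.fresh (0, 0)) s.used ∧ Y ∉ s.solved.map Prod.fst :=
      fun u hu Y hY => (hu Y hY).imp_left (Finset.mem_insert_of_mem ·)
    refine ⟨hn, fun Y hY => Finset.mem_insert_of_mem (hk Y hY), fun p hp => hmono _ (hsc p hp),
      List.forall_mem_cons.2 ⟨⟨hmono _ hc.1, fun Y hY => ?_⟩,
        fun e he => (hrest e he).imp (hmono _) (hmono _)⟩⟩
    rcases mem_vars_absorb hY with hY | rfl
    · exact hmono _ hc.2 Y hY
    · exact ⟨Finset.mem_insert_self _ _, fun h => c.fresh_new _ (hk _ h)⟩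
  | decompose f ss ts h =>
    rw [h] at hc
    refine ⟨hn, hk, hsc, List.forall_mem_append.2 ⟨fun e he => ?_, hrest⟩⟩
    have := vars_of_mem_argEqs he
    exact ⟨fun Y hY => hc.1 Y (this.1 hY), fun Y hY => hc.2 Y (this.2 hY)⟩
  | decompose_empty h => exact ⟨hn, hk, hsc, hrest⟩
  | aciStep l r h hl hr hlr B hB hB' =>
    rw [h] at hc
    let N := (Guess.box (setForm l r)).image c.fresh
    -- The variables that may occur after `ρ`, apart from the removal of the keys of `E₁`, which
    -- acyclicity supplies.
    let W := (s.used ∪ N).filter fun Y => Y ∉ s.solved.map Prod.fst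
    have hW : ∀ u, s.Clean u → u.vars ⊆ W := fun u hu Y hY =>
      Finset.mem_filter.2 ⟨Finset.mem_union_left _ (hu Y hY).1, (hu Y hY).2⟩
    have hE₁W : ∀ p ∈ B.E₁ c.fresh, p.2.vars ⊆ W := by
      rintro ⟨X, t⟩ hp Y hY
      rcases Term.mem_vars_iff.1 hY with hY | ⟨q, hq, hY⟩
      · obtain ⟨b, hb, rfl⟩ := B.E₁_topVars _ hp hY
        exact Finset.mem_filter.2 ⟨Finset.mem_union_right _ (Finset.mem_image_of_mem _ hb),
          fun h => c.fresh_new _ (hk _ h)⟩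
      · rcases B.E₁_topComps _ hp hq with ⟨j, rfl⟩ | ⟨i, rfl⟩
        · exact hW _ hc.1 (Term.mem_vars_iff.2 (.inr ⟨_, get_P_mem j, hY⟩))
        · exact hW _ hc.2 (Term.mem_vars_iff.2 (.inr ⟨_, get_Q_mem i, hY⟩))
    have hkeys : (substSolved (B.rho c.fresh)
        (s.solved ++ (B.E₁ c.fresh).map fun p => (p.1, .var p.1))).map Prod.fst =
        s.solved.map Prod.fst ++ (B.E₁ c.fresh).map Prod.fst := by
      rw [map_fst_substSolved, List.map_append, List.map_map]
      rfl
    have hkey : ∀ X ∈ (B.E₁ c.fresh).map Prod.fst,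
        X ∈ s.used ∧ X ∉ s.solved.map Prod.fst := fun X hX =>
      (Guess.mem_E₁_keys.1 hX).elim (fun h => hc.1 X (Term.mem_vars_iff.2 (.inl h)))
        fun h => hc.2 X (Term.mem_vars_iff.2 (.inl h))
    have hclean : ∀ u, s.Clean u → ∀ Y ∈ (u.subst (B.rho c.fresh)).vars, Y ∈ s.used ∪ N ∧
        Y ∉ s.solved.map Prod.fst ++ (B.E₁ c.fresh).map Prod.fst := by
      intro u hu Y hY
      have h₁ := Finset.mem_filter.1 (iterSubst_vars_subset hE₁W (hW u hu) _ hY)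
      obtain ⟨Z, -, hZ⟩ := Term.mem_vars_subst.1 hY
      have h₂ := iterSubst_vars_notMem hB' Z Y hZ
      exact ⟨h₁.1, fun h => (List.mem_append.1 h).elim h₁.2 h₂⟩
    have hE₂ : ∀ e ∈ B.E₂ ++ c.rest, s.Clean e.1 ∧ s.Clean e.2 := by
      refine List.forall_mem_append.2 ⟨fun e he => ?_, hrest⟩
      obtain ⟨i, j, -, he⟩ := B.mem_E₂.1 he
      have := vars_of_mem_argEqs he
      exact ⟨fun Y hY => hc.1 Y (Term.mem_vars_iff.2 (.inr ⟨_, get_P_mem j, this.1 hY⟩)),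
        fun Y hY => hc.2 Y (Term.mem_vars_iff.2 (.inr ⟨_, get_Q_mem i, this.2 hY⟩))⟩
    refine ⟨?_, ?_, ?_, ?_⟩
    · rw [hkeys, List.nodup_append]
      refine ⟨hn, Guess.E₁_keys_nodup, ?_⟩
      rintro X hX _ hX' rfl
      exact (hkey X hX').2 hX
    · rw [hkeys]
      refine List.forall_mem_append.2 ⟨fun X hX => Finset.mem_union_left _ (hk X hX),
        fun X hX => Finset.mem_union_left _ (hkey X hX).1⟩
    · simp only [State.Clean, hkeys]
      simp only [substSolved, List.forall_mem_map, List.forall_mem_append]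
      refine ⟨fun p hp => hclean _ (hsc p hp), fun p hp => hclean _ fun Y hY => ?_⟩
      rw [Term.vars, Finset.mem_singleton] at hY
      exact hY ▸ hkey _ (List.mem_map.2 ⟨p, hp, rfl⟩)
    · simp only [State.Clean, hkeys, List.forall_mem_map]
      exact fun e he => ⟨hclean _ (hE₂ e he).1, hclean _ (hE₂ e he).2⟩

end Procedure

/-! ### Termination along a unifier, and completeness of the procedure -/

section Termination

variable {F : Type u} {ar : F → ℕ} {V : Type v}

/-- The nesting depths, under `τ`, of the left-hand sides of the pending equations. -/
def heights (E : List (Eqn ar V)) (τ : Subst ar V) : Multiset ℕ :=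
  (E.map fun e => (e.1.subst τ).height : Multiset ℕ)

theorem Choice.heights_eq {s : State ar V} (c : Choice s) (τ : Subst ar V) :
    heights s.pending τ = (c.eqn.1.subst τ).height ::ₘ heights c.rest τ :=
  (Multiset.coe_eq_coe.2 (c.perm.map _)).symm

/-- Applying `ρ` may enlarge the terms, but their instances under `τ` stay the same modulo ACI1.
Measuring instances is what makes variable elimination harmless. -/
theorem heights_map_subst [DecidableEq V] {ρ τ : Subst ar V}
    (h : ∀ X, EqACI1 ((ρ X).subst τ) (τ X)) (E : List (Eqn ar V)) :
    heights (E.map (Eqn.subst ρ)) τ = heights E τ := by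
  rw [heights, heights, List.map_map]
  congr 1
  exact List.map_congr_left fun e _ => Term.height_congr (eqACI1_subst_of_forall h _)

/-- One step of the multiset order. The case of empty `E'` is included: discarding an equation also
counts as a decrease. -/
theorem cutExpand_heights {E E' : List (Eqn ar V)} {τ : Subst ar V} {n : ℕ}
    (h : ∀ e ∈ E', (e.1.subst τ).height < n) :
    Relation.CutExpand (· < ·) (heights (E' ++ E) τ) (n ::ₘ heights E τ) := by
  refine ⟨heights E' τ, n, ?_, ?_⟩
  · intro k hk
    obtain ⟨e, he, rfl⟩ := List.mem_map.1 (Multiset.mem_coe.1 hk)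
    exact h e he
  · have : heights (E' ++ E) τ = heights E' τ + heights E τ := by
      simp [heights]
    rw [this, ← Multiset.singleton_add]
    abel

open Classical in
/-- The number of rules that may be applied to the equation before it is solved or split. -/
noncomputable def rank (e : Eqn ar V) : ℕ :=
  if ¬ e.1.IsVar ∧ e.2.IsVar then 2
  else if ∃ X, e.1 = .var X ∧ ¬ e.2.IsVar ∧ X ∈ e.2.topVars then 1 else 0

/-- The sum of the ranks of the equations of a system. -/
noncomputable def totalRank (E : List (Eqn ar V)) : ℕ := (E.map rank).sum

theorem Choice.totalRank_eq {s : State ar V} (c : Choice s) :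
    totalRank s.pending = rank c.eqn + totalRank c.rest := by
  rw [totalRank, ← (c.perm.map rank).sum_eq, List.map_cons, List.sum_cons, totalRank]

theorem Term.IsVar.exists_eq {t : Term ar V} (h : t.IsVar) : ∃ X, t = .var X := by
  cases t <;> first | exact ⟨_, rfl⟩ | exact h.elim

/-- The first system is closer to termination than the second one, along the unifier `τ`. -/
def Smaller (E' E : List (Eqn ar V)) (τ : Subst ar V) : Prop :=
  Relation.CutExpand (· < ·) (heights E' τ) (heights E τ) ∨
    heights E' τ = heights E τ ∧ totalRank E' < totalRank E

theorem Choice.smaller_of_append {s : State ar V} (c : Choice s) {E : List (Eqn ar V)}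
    {τ : Subst ar V} (h : ∀ e ∈ E, (e.1.subst τ).height < (c.eqn.1.subst τ).height) :
    Smaller (E ++ c.rest) s.pending τ := by
  rw [Smaller, c.heights_eq]
  exact .inl (cutExpand_heights h)

theorem Choice.smaller_of_rank {s : State ar V} (c : Choice s) {e : Eqn ar V} {τ : Subst ar V}
    (h : (e.1.subst τ).height = (c.eqn.1.subst τ).height) (he : rank e < rank c.eqn) :
    Smaller (e :: c.rest) s.pending τ := by
  refine .inr ⟨?_, ?_⟩
  · rw [c.heights_eq, ← h]
    rfl
  · rw [c.totalRank_eq, totalRank, List.map_cons, List.sum_cons, totalRank]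
    omega

variable [DecidableEq V]

theorem Choice.smaller_of_map {s : State ar V} (c : Choice s) {E : List (Eqn ar V)}
    {ρ τ : Subst ar V} (hρ : ∀ X, EqACI1 ((ρ X).subst τ) (τ X))
    (h : ∀ e ∈ E, (e.1.subst τ).height < (c.eqn.1.subst τ).height) :
    Smaller ((E ++ c.rest).map (Eqn.subst ρ)) s.pending τ := by
  rw [Smaller, c.heights_eq, heights_map_subst hρ]
  exact .inl (cutExpand_heights h)

theorem State.Clean.subst_eq {s : State ar V} {t : Term ar V} (h : s.Clean t) {σ τ : Subst ar V}
    (hτ : ∀ X ∈ s.used, τ X = σ X) : t.subst τ = t.subst σ :=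
  Term.subst_eq_of_vars fun Y hY => hτ Y (h Y hY).1

theorem State.WF.sat_of_agree {s : State ar V} (hs : s.WF) {σ τ : Subst ar V} (hσ : s.Sat σ)
    (hτ : ∀ X ∈ s.used, τ X = σ X) : s.Sat τ := by
  refine ⟨fun p hp => ?_, fun e he => ?_⟩
  · rw [hτ _ (hs.key_used _ (List.mem_map.2 ⟨p, hp, rfl⟩)), (hs.solved_clean p hp).subst_eq hτ]
    exact hσ.solved p hp
  · rw [(hs.pending_clean e he).1.subst_eq hτ, (hs.pending_clean e he).2.subst_eq hτ]
    exact hσ.pending e he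

theorem State.WF.heights_of_agree {s : State ar V} (hs : s.WF) {σ τ : Subst ar V}
    (hτ : ∀ X ∈ s.used, τ X = σ X) : heights s.pending τ = heights s.pending σ := by
  rw [heights, heights]
  congr 1
  exact List.map_congr_left fun e he => by rw [(hs.pending_clean e he).1.subst_eq hτ]

/-- An `aci_step` guided by a unifier. -/
theorem exists_aciStep {s : State ar V} (c : Choice s) (hs : s.WF) {σ : Subst ar V}
    (hσ : s.Sat σ) {l r : Term ar V} (h : c.eqn = (l, r)) (hl : ¬ l.IsVar) (hr : ¬ r.IsVar)
    (hlr : l.IsUnion ∨ r.IsUnion) :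
    ∃ s' τ, Step s c s' ∧ s'.Sat τ ∧ (∀ X ∈ s.used, τ X = σ X) ∧
      Smaller s'.pending s.pending τ := by
  have heq := (c.isUnifier_iff.1 hσ.pending).1
  have hc := hs.pending_clean _ c.eqn_mem
  rw [h] at heq hc
  have hAl : ∀ p, c.fresh p ∉ l.vars := fun p hp => c.fresh_new p (hc.1 _ hp).1
  have hAr : ∀ p, c.fresh p ∉ r.vars := fun p hp => c.fresh_new p (hc.2 _ hp).1
  obtain ⟨B, hB, τ, hτ, h₁, h₂⟩ := exists_guess heq c.fresh_injective hAl hAr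
  have hagree : ∀ X ∈ s.used, τ X = σ X := fun X hX => hτ X fun p hp => c.fresh_new p (hp ▸ hX)
  have hsat := hs.sat_of_agree hσ hagree
  have hρ : ∀ X, EqACI1 ((B.rho c.fresh X).subst τ) (τ X) :=
    iterSubst_eqACI1 (fun X => h₁.substOf X) _
  refine ⟨_, τ, .aciStep l r h hl hr hlr B hB
    (Guess.acyclic_of_solves h₁ fun p => ⟨hAl p, hAr p⟩), ⟨?_, ?_⟩, hagree,
    c.smaller_of_map hρ fun e he => ?_⟩
  · refine (solves_substSolved hρ).2 (List.forall_mem_append.2 ⟨hsat.solved, ?_⟩)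
    simp only [List.forall_mem_map]
    exact fun p _ => .refl _
  · refine (isUnifier_map_subst hρ).2 (isUnifier_append.2 ⟨(B.E₂_iff hB).2 h₂, ?_⟩)
    exact (c.isUnifier_iff.1 hsat.pending).2
  -- The left-hand sides in `E₂` are arguments of compound terms of `l`, hence strictly shallower
  -- than `l`.
  · obtain ⟨i, j, -, he⟩ := B.mem_E₂.1 he
    rw [h]
    exact (height_of_mem_argEqs he τ).trans_le (Term.height_topComp_le (get_P_mem j))

/-- A step on an equation with a variable on the left, guided by a unifier. -/
theorem exists_step_var {s : State ar V} (c : Choice s) (hs : s.WF) {σ : Subst ar V}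
    (hσ : s.Sat σ) {X : V} {t : Term ar V} (h : c.eqn = (.var X, t)) :
    ∃ s' τ, Step s c s' ∧ s'.Sat τ ∧ (∀ X ∈ s.used, τ X = σ X) ∧
      Smaller s'.pending s.pending τ := by
  obtain ⟨heq, hrest⟩ := c.isUnifier_iff.1 hσ.pending
  have hc := hs.pending_clean _ c.eqn_mem
  rw [h] at heq hc
  replace heq : EqACI1 (σ X) (t.subst σ) := heq
  by_cases hXt : X ∈ t.vars
  · by_cases ht : t.IsVar
    · obtain ⟨Y, rfl⟩ := ht.exists_eq
      obtain rfl : X = Y := by simpa [Term.vars] using hXt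
      exact ⟨_, σ, .trivial X h, ⟨hσ.solved, hrest⟩, fun _ _ => rfl,
        c.smaller_of_append (E := []) (by simp)⟩
    · have hX' : ∀ p ∈ t.topComps, X ∉ p.toTerm.vars := fun p hp hX => by
        have := Term.height_var_lt_topComp (σ := σ) hp hX
        rw [← Term.height_congr heq] at this
        exact lt_irrefl _ this
      have hX : X ∈ t.topVars := (Term.mem_vars_iff.1 hXt).resolve_right
        fun ⟨p, hp, h⟩ => hX' p hp h
      have hXu : X ∈ s.used := (hc.1 X (by simp [Term.vars])).1
      have hN := c.fresh_new (0, 0)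
      -- Since `X` already contains the rest `t'` of `t`, taking the whole value of `X` for `N`
      -- solves `X = t' ∪ N`.
      let τ := Function.update σ (c.fresh (0, 0)) (σ X)
      have hagree : ∀ Y ∈ s.used, τ Y = σ Y := fun Y hY =>
        Function.update_of_ne (ne_of_mem_of_not_mem hY hN) _ _
      have hτN : τ (c.fresh (0, 0)) = σ X := Function.update_self _ _ _
      have hsat := hs.sat_of_agree hσ hagree
      have heq' := (c.isUnifier_iff.1 hsat.pending).1
      rw [h] at heq'
      refine ⟨_, τ, .absorb X t h ht hX hX', ⟨hsat.solved, isUnifier_cons.2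
        ⟨?_, (c.isUnifier_iff.1 hsat.pending).2⟩⟩, hagree, c.smaller_of_rank (by rw [h]) ?_⟩
      · rw [eqACI1_iff]
        intro a
        have ha := has_congr heq' a
        simp only [Term.subst, has_subst] at ha
        simp only [Term.subst, has_absorb_subst, hτN, ← hagree X hXu]
        constructor
        · exact fun h => .inr (.inr h)
        · rintro (h | ⟨Y, hY, -, h⟩ | h)
          · exact ha.2 (.inr h)
          · exact ha.2 (.inl ⟨Y, hY, h⟩)
          · exact h
      · have h₁ : rank c.eqn = 1 := by
          rw [h, rank, if_neg (fun h => h.1 trivial), if_pos ⟨X, rfl, ht, hX⟩]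
        rw [h₁, rank, if_neg (fun h => h.1 trivial), if_neg]
        · exact Nat.zero_lt_one
        · rintro ⟨Y, hY, -, hY'⟩
          cases hY
          exact notMem_topVars_absorb (ne_of_mem_of_not_mem hXu hN).symm hY'
  · have hρ := substOf_singleton_eqACI1 heq
    exact ⟨_, σ, .bind X t h hXt, ⟨List.forall_mem_cons.2
      ⟨heq, (solves_substSolved hρ).2 hσ.solved⟩, (isUnifier_map_subst hρ).2 hrest⟩,
      fun _ _ => rfl, c.smaller_of_map (E := []) hρ (by simp)⟩

/-- A unifier guides the procedure through every state with pending equations. -/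
theorem exists_step {s : State ar V} (c : Choice s) (hs : s.WF) {σ : Subst ar V}
    (hσ : s.Sat σ) :
    ∃ s' τ, Step s c s' ∧ s'.Sat τ ∧ (∀ X ∈ s.used, τ X = σ X) ∧
      Smaller s'.pending s.pending τ := by
  obtain ⟨heq, hrest⟩ := c.isUnifier_iff.1 hσ.pending
  obtain ⟨l, r, h⟩ : ∃ l r, c.eqn = (l, r) := ⟨_, _, rfl⟩
  have haci := exists_aciStep c hs hσ h
  have horient : ¬ l.IsVar → r.IsVar → ∃ s' τ, Step s c s' ∧ s'.Sat τ ∧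
      (∀ X ∈ s.used, τ X = σ X) ∧ Smaller s'.pending s.pending τ := by
    intro hl hr
    obtain ⟨X, rfl⟩ := hr.exists_eq
    rw [h] at heq
    refine ⟨_, σ, .orient l X h hl, ⟨hσ.solved, isUnifier_cons.2 ⟨heq.symm, hrest⟩⟩,
      fun _ _ => rfl, c.smaller_of_rank ?_ ?_⟩
    · rw [h]
      exact (Term.height_congr heq).symm
    -- The oriented equation may still need absorption and then has rank 1, whence the value 2 here.
    · have h₂ : rank c.eqn = 2 := by rw [h, rank, if_pos ⟨hl, trivial⟩]
      rw [h₂, rank, if_neg (fun h => h.1 trivial)]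
      split_ifs <;> omega
  rw [h] at heq
  cases l with
  | var X => exact exists_step_var c hs hσ h
  | union l₁ l₂ =>
    by_cases hr : r.IsVar
    · exact horient id hr
    · exact haci id hr (.inl trivial)
  | empty =>
    cases r with
    | var X => exact horient id trivial
    | union r₁ r₂ => exact haci id id (.inr trivial)
    | empty =>
      exact ⟨_, σ, .decompose_empty h, ⟨hσ.solved, hrest⟩, fun _ _ => rfl,
        c.smaller_of_append (E := []) (by simp)⟩
    | app g ts => exact (not_eqACI1_app_empty heq.symm).elim
  | app f ss =>
    cases r with
    | var X => exact horient id trivial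
    | union r₁ r₂ => exact haci id id (.inr trivial)
    | empty => exact (not_eqACI1_app_empty heq).elim
    | app g ts =>
      obtain rfl : f = g := EqACI1.head_eq heq
      refine ⟨_, σ, .decompose f ss ts h, ⟨hσ.solved, isUnifier_append.2
        ⟨isUnifier_argEqs.2 heq, hrest⟩⟩, fun _ _ => rfl, c.smaller_of_append fun e he => ?_⟩
      rw [h]
      exact height_of_mem_argEqs he σ

/-- Along a unifier the procedure terminates. -/
theorem exists_reaches_final {S : Strategy ar V} {E : List (Eqn ar V)} (m : Multiset ℕ) :
    ∀ (n : ℕ) (hist : List (State ar V)) (s : State ar V) (σ : Subst ar V),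
      Reaches S E hist s → s.WF → s.Sat σ → heights s.pending σ = m → totalRank s.pending = n →
      ∃ hist' s' τ, Reaches S E hist' s' ∧ s'.pending = [] ∧ s'.WF ∧ s'.Sat τ ∧
        s.used ⊆ s'.used ∧ ∀ X ∈ s.used, τ X = σ X := by
  have hwf : WellFounded (Relation.CutExpand ((· < ·) : ℕ → ℕ → Prop)) := Nat.lt_wfRel.wf.cutExpand
  induction m using hwf.induction with
  | _ m ihm =>
    intro n
    induction n using Nat.strong_induction_on with
    | _ n ihn =>
      intro hist s σ hreach hs hσ hm hn
      by_cases hp : s.pending = []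
      · exact ⟨hist, s, σ, hreach, hp, hs, hσ, Finset.Subset.refl _, fun _ _ => rfl⟩
      obtain ⟨s₁, σ₁, hstep, hσ₁, hagree, hsmall⟩ := exists_step (S hist s hp) hs hσ
      have hnext : ∃ hist' s' τ, Reaches S E hist' s' ∧ s'.pending = [] ∧ s'.WF ∧ s'.Sat τ ∧
          s₁.used ⊆ s'.used ∧ ∀ X ∈ s₁.used, τ X = σ₁ X := by
        -- The extension `σ₁` agrees with `σ` on the old state, so the old measure may be computed
        -- with either; the induction is lexicographic, first on depths and then on rank.
        rw [Smaller, hs.heights_of_agree hagree, hm, hn] at hsmall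
        rcases hsmall with hlt | ⟨heq, hlt⟩
        · exact ihm _ hlt _ _ _ _ (.step hp hreach hstep) (hstep.wf hs) hσ₁ rfl rfl
        · exact ihn _ hlt _ _ _ (.step hp hreach hstep) (hstep.wf hs) hσ₁ heq rfl
      obtain ⟨hist', s', τ, hr, hp', hs', hτ, hu, ha⟩ := hnext
      exact ⟨hist', s', τ, hr, hp', hs', hτ, hstep.used_subset.trans hu,
        fun X hX => (ha X (hstep.used_subset hX)).trans (hagree X hX)⟩

theorem vars_subset_sysVars {E : List (Eqn ar V)} {e : Eqn ar V} (he : e ∈ E) :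
    e.1.vars ⊆ sysVars E ∧ e.2.vars ⊆ sysVars E := by
  induction E with
  | nil => simp at he
  | cons d E ih =>
    have hd : sysVars (d :: E) = d.1.vars ∪ d.2.vars ∪ sysVars E := rfl
    rw [hd]
    rcases List.mem_cons.1 he with rfl | he
    · exact ⟨Finset.subset_union_left.trans Finset.subset_union_left,
        Finset.subset_union_right.trans Finset.subset_union_left⟩
    · exact (ih he).imp (·.trans Finset.subset_union_right) (·.trans Finset.subset_union_right)

theorem wf_start (E : List (Eqn ar V)) : (⟨[], E, sysVars E⟩ : State ar V).WF where
  nodup := List.nodup_nil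
  key_used := by simp
  solved_clean := by simp
  pending_clean e he :=
    ⟨fun Y hY => ⟨(vars_subset_sysVars he).1 hY, by simp⟩,
      fun Y hY => ⟨(vars_subset_sysVars he).2 hY, by simp⟩⟩

theorem Reaches.wf_and_sound {S : Strategy ar V} {E : List (Eqn ar V)} {hist : List (State ar V)}
    {s : State ar V} (h : Reaches S E hist s) : s.WF ∧ ∀ τ, s.Sat τ → IsUnifier E τ := by
  induction h with
  | start => exact ⟨wf_start E, fun τ hτ => hτ.pending⟩
  | step hs _ hstep ih => exact ⟨hstep.wf ih.1, fun τ hτ => ih.2 τ (hstep.sat hτ)⟩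

/-- The substitution read off a final state unifies the state. -/
theorem State.WF.sat_substOf {s : State ar V} (hs : s.WF) (hp : s.pending = []) :
    s.Sat (substOf s.solved) := by
  refine ⟨?_, by simp [hp, IsUnifier]⟩
  rintro ⟨X, t⟩ h
  -- No solved variable occurs in a right-hand side, so the substitution is idempotent.
  rw [substOf_of_mem hs.nodup h, show t.subst (substOf s.solved) = t.subst .var from
    Term.subst_eq_of_vars fun Y hY => substOf_of_notMem (hs.solved_clean _ h Y hY).2,
    Term.subst_var]
  exact .refl _

end Termination

end ACI1

/-! ### Correctness and completeness of `general_aci` -/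

theorem theorem1 {F : Type*} (ar : F → ℕ) {V : Type*} [DecidableEq V] [Infinite V]
    (S : ACI1.Strategy ar V) (E : List (ACI1.Eqn ar V)) :
    ACI1.IsCompleteSetOfUnifiers E {θ | ACI1.Returns S E θ} := by
  refine ⟨?_, fun σ hσ => ?_⟩
  · rintro θ ⟨hist, s, hreach, hp, rfl⟩
    have := hreach.wf_and_sound
    exact this.2 _ (this.1.sat_substOf hp)
  · obtain ⟨hist, s, τ, hreach, hp, hs, hτ, hused, hagree⟩ :=
      ACI1.exists_reaches_final (S := S) _ _ _ _ σ .start (ACI1.wf_start E)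
        ⟨by simp [ACI1.Solves], hσ⟩ rfl rfl
    -- The witness for `δ` is `τ` cut down to the finitely many used variables; the values `θ(X)`
    -- for `X` in the input involve no others.
    refine ⟨_, ⟨hist, s, hreach, hp, rfl⟩, fun X => if X ∈ s.used then τ X else .var X,
      s.used.finite_toSet.subset fun X hX => ?_, fun X hX => ?_⟩
    · by_contra h
      exact hX (if_neg h)
    · have hvars : ∀ Y ∈ (ACI1.substOf s.solved X).vars, Y ∈ s.used := by
        intro Y hY
        by_cases hk : X ∈ s.solved.map Prod.fst
        · exact (hs.solved_clean _ (ACI1.exists_mem_substOf hk) Y hY).1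
        · rw [ACI1.substOf_of_notMem hk, ACI1.Term.vars, Finset.mem_singleton] at hY
          exact hY ▸ hused hX
      rw [← hagree X hX, ACI1.Term.subst_eq_of_vars (τ := τ) fun Y hY => if_pos (hvars Y hY)]
      exact (hτ.solved.substOf X).symm
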